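/- Consider any station of a single-route transit line whose vehicles have capacity $C$. Let $Q_l$ be the number of passengers queuing when vehicle $l$ arrives, $S_l\in\{0,\dots,C\}$ the number of available spaces in vehicle $l$ after alighting, and $Y_l$ the number of passengers arriving between vehicles $l$ and $l+1$. The queue evolves as $Q_{l+1}=\max(Q_l-S_l,0)+Y_l$. Given the headway $H_{l+1}\ge 0$ between the two vehicles, $Y_l$ is Poisson with parameter $\lambda H_{l+1}$, where $\lambda>0$ is the passenger arrival rate and the headways are identically distributed. For each $l$ the variables $Q_l,S_l,Y_l$ are independent. Assume that the steady state exists, i.e. that the laws of $Q_l,S_l,Y_l$ converge as $l\to\infty$ to the laws of nonnegative integer random variables $Q,S,Y$. Assume that $\mathbb E[Y^3]<\infty$ and that the station is stable, $\bar Y<\bar S$. Here $\bar S=\mathbb E[S]$ and $\bar Y=\mathbb E[Y]$; let $\bar{\bar S},\bar{\bar{\bar S}}$ and $\bar{\bar Y},\bar{\bar{\bar Y}}$ be the second and third central moments of $S$ and $Y$. Put $s_u=\mathbb P(S=u)$, $Y(z)=\mathbb E[z^Y]$, and $$\mathrm{Den}(z)=\frac{z^C}{Y(z)}-\sum_{u=0}^{C}s_u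 z^{C-u},$$ the denominator of the probability generating function of $Q$. Then $\mathrm{Den}$ has, counted with multiplicity, exactly $C-1$ roots $z_1^*,\dots,z_{C-1}^*$ other than $1$ in the closed unit disk $|z|\le 1$, $Q$ has a finite second moment, and $$\mathbb E[Q]=\frac{\bar{\bar S}+\bar{\bar Y}+(\bar S-\bar Y)\,[1+2(\bar S-C)]-(\bar S-\bar Y)^2}{2(\bar S-\bar Y)}+\sum_{i=1}^{C-1}\frac{1}{1-z_i^*},$$ $$\operatorname{Var}[Q]=\frac{1}{12(\bar S-\bar Y)^2}\Big[-4(\bar{\bar{\bar S}}-\bar{\bar{\bar Y}})(\bar S-\bar Y)+3(\bar{\bar S}+\bar{\bar Y})^2-\big[6(\bar{\bar S}-\bar{\bar Y})-1\big](\bar S-\bar Y)^2-(\bar S-\bar Y)^4\Big]-\sum_{i=1}^{C-1}\frac{z_i^*}{(1-z_i^*)^2}.$$ -/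

import Mathlib

open MeasureTheory ProbabilityTheory Filter Topology

/-- The bulk-service queue at one station, observed at the successive vehicle arrivals `l`.
`H l` is the headway between vehicles `l - 1` and `l`; `Q l` is the number of queuing passengers
when vehicle `l` arrives; `S l` is the number of available spaces in vehicle `l` after alighting;
`Y l` is the number of passengers arriving between vehicles `l` and `l + 1`. The vehicle capacity
is `C` and the passenger arrival rate is `lam`. -/
structure IsBulkServiceQueue {Ω : Type*} [MeasurableSpace Ω] (P : Measure Ω) (C : ℕ) (lam : ℝ)
    (H : ℕ → Ω → ℝ) (Q S Y : ℕ → Ω → ℕ) : Prop where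
  measurable_H : ∀ l, Measurable (H l)
  measurable_Q : ∀ l, Measurable (Q l)
  measurable_S : ∀ l, Measurable (S l)
  measurable_Y : ∀ l, Measurable (Y l)
  /-- the passenger arrival rate is positive -/
  rate_pos : 0 < lam
  /-- there is no overtaking, so headways are nonnegative -/
  headway_nonneg : ∀ l, ∀ᵐ ω ∂P, 0 ≤ H l ω
  /-- all vehicles have the same headway law -/
  headway_identDistrib : ∀ l, IdentDistrib (H l) (H 0) P P
  /-- given the headway `H (l + 1)`, `Y l` is Poisson with parameter `lam * H (l + 1)` -/
  arrivals_poisson : ∀ (l k : ℕ) (B : Set ℝ), MeasurableSet B →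
    P {ω | H (l + 1) ω ∈ B ∧ Y l ω = k} =
      ∫⁻ ω in {ω | H (l + 1) ω ∈ B}, poissonMeasure (lam * H (l + 1) ω).toNNReal {k} ∂P
  /-- the available space is at most the vehicle capacity -/
  space_le : ∀ l ω, S l ω ≤ C
  /-- `min (Q l) (S l)` passengers board vehicle `l`, the other `Q l - S l` (or `0`) are left
  behind (truncated subtraction is meant), and the next arrivals join them -/
  queue_succ : ∀ l ω, Q (l + 1) ω = (Q l ω - S l ω) + Y l ω
  /-- the queue met by a vehicle, its available space and the subsequent arrivals are
  mutually independent -/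
  indep : ∀ l, iIndepFun ![Q l, S l, Y l] P

/-- `ν` is the steady-state law of the `ℕ`-valued process `X`:
`ν {k}` is the limit of `P (X l = k)` as `l → ∞`, for every `k`. -/
def IsSteadyState {Ω : Type*} [MeasurableSpace Ω] (P : Measure Ω) (X : ℕ → Ω → ℕ)
    (ν : Measure ℕ) : Prop :=
  ∀ k : ℕ, Tendsto (fun l => P.real {ω | X l ω = k}) atTop (𝓝 (ν.real {k}))

/-- The mean of a law on `ℕ`. -/
noncomputable def lawMean (ν : Measure ℕ) : ℝ := ∫ k : ℕ, (k : ℝ) ∂ν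

/-- The `p`-th central moment of a law on `ℕ`. -/
noncomputable def lawCentral (ν : Measure ℕ) (p : ℕ) : ℝ :=
  centralMoment (fun k : ℕ => (k : ℝ)) p ν

/-- The probability generating function of a law on `ℕ`. -/
noncomputable def lawPGF (ν : Measure ℕ) (z : ℂ) : ℂ := ∑' k : ℕ, (ν.real {k} : ℂ) * z ^ k

/-- The denominator `z ^ C / Y(z) - ∑ u ≤ C, s_u z ^ (C - u)` of the probability generating
function of the queue length, where `νS` is the law of the available space and `νY` the law of
the arrivals within a headway. -/
noncomputable def queueDen (C : ℕ) (νS νY : Measure ℕ) (z : ℂ) : ℂ :=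
  z ^ C / lawPGF νY z - ∑ u ∈ Finset.range (C + 1), (νS.real {u} : ℂ) * z ^ (C - u)

/-- `z` lists, each as often as its multiplicity, the roots other than `1` of `f` in the closed
unit disk. (`analyticOrderAt f w` is the multiplicity of `w` as a root of `f`; it is `0` if
`f w ≠ 0`, and also where `f` is not analytic, in particular at a pole of `f`.) -/
def IsNonunitRootList (f : ℂ → ℂ) {m : ℕ} (z : Fin m → ℂ) : Prop :=
  (∀ i, ‖z i‖ ≤ 1 ∧ z i ≠ 1) ∧
    ∀ w : ℂ, ‖w‖ ≤ 1 → w ≠ 1 → ((Nat.card {i // z i = w} : ℕ) : ℕ∞) = analyticOrderAt f w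

/-!
Write `s`, `y`, `q` for the steady-state laws of the available space, the arrivals and the queue,
`S*(z) = ∑ s_u z ^ (C - u)`, and `Y(z)`, `Q(z)` for the generating functions.

*The functional equation.* Since `S ≤ C`, the event `Q_{l+1} = k` involves finitely many values of
`(Q_l, S_l, Y_l)`, so the recursion passes to the limit: `q` is the law of `(Q - S)⁺ + Y` with
independent `Q, S, Y` (`IsBulkServiceQueue.map_lindleyMap`). On `‖z‖ ≤ 1` this says
`Q(z) (z ^ C - Y(z) S*(z)) = Y(z) (z - 1) M(z)`, where `M` (`boundaryPoly`) is a polynomial of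
degree at most `C - 1` (`lawPGF_mul_eq`). The factor `z - 1` also splits off on the left:
`z ^ C - Y(z) S*(z) = (z - 1) E(z)`, where `E` (`reducedDen`) is continuous on the closed disk,
analytic inside, and `E(1) = 𝔼 S - 𝔼 Y > 0`. Hence `Q E = Y M`, and `M(1) = E(1) ≠ 0`.

*Counting the roots.* The law `y` is a mixed Poisson law, so `y₀ > 0`, and either `y₁ > 0` or
`Y = 0` almost surely. Replacing arrival numbers from `N` on by `0` turns `E` into a polynomial
`E_N` (`truncDen`). For `r > 1` close to `1`, Rouché's theorem on `‖z‖ = r` compares `(z - 1) E_N`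
with `z ^ C`, and `E_N` has exactly `C - 1` roots in the closed disk (`card_roots_truncDen`). If
`y₁ > 0`, then `E` has no zero on the unit circle, so it is bounded below on some annulus
`ρ ≤ ‖z‖ ≤ 1`; as `E_N → E` uniformly, Rouché's theorem on `‖z‖ = ρ` gives `C - 1` zeros of `E`
(`exists_reducedDen_eq_polynomial_mul`). If `Y = 0`, then `E = E_0` is a polynomial, whose roots
may lie on the unit circle. In both cases the zeros of `E` are the roots of the denominator other
than `1` (where `Y` vanishes the denominator is not analytic and `E` does not vanish), and they
are roots of `M`; comparing degrees, `M(z) = c ∏ (z - z_i)`.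

*Moments.* The functions `tailPGF a m` are the successive difference quotients at `1` of a
generating function: `tailPGF a m z = 𝔼[choose X m] + (z - 1) tailPGF a (m + 1) z`. Since their
coefficients are nonnegative, a difference quotient that has a limit as `x → 1⁻` already has a
convergent coefficient sum, equal to that limit (`factMoment_succ_of_tendsto`). Expanding
`Q E = Y M` at `1` to second order, which uses three moments of `Y`, therefore yields both
finiteness and the values of the first two factorial moments of the queue
(`factMoment_eq_of_mul_reducedDen_eq`).
-/

/-! ### Rouché's theorem and counting zeros -/

theorem differentiableAt_of_differentiableOn_isOpen {f : ℂ → ℂ} {U : Set ℂ} (hU : IsOpen U)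
    (hf : DifferentiableOn ℂ f U) {z : ℂ} (hz : z ∈ U) : DifferentiableAt ℂ f z :=
  hf.differentiableAt (hU.mem_nhds hz)

/-- Rouché's theorem for the integral of the logarithmic derivative: `f / g` stays in the slit
plane on the circle, so `logDeriv f - logDeriv g` has the primitive `log (f / g)` there. -/
theorem circleIntegral_logDeriv_eq_of_norm_sub_lt {f g : ℂ → ℂ} {U : Set ℂ} (hU : IsOpen U)
    {R : ℝ} (hR : 0 ≤ R) (hsub : Metric.sphere (0 : ℂ) R ⊆ U)
    (hf : DifferentiableOn ℂ f U) (hg : DifferentiableOn ℂ g U)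
    (hlt : ∀ z ∈ Metric.sphere (0 : ℂ) R, ‖f z - g z‖ < ‖g z‖) :
    (∮ z in C(0, R), logDeriv f z) = ∮ z in C(0, R), logDeriv g z := by
  have hg0 : ∀ z ∈ Metric.sphere (0 : ℂ) R, g z ≠ 0 := fun z hz h => by
    have := hlt z hz
    rw [h, norm_zero] at this
    exact absurd this (not_lt.2 (norm_nonneg _))
  have hf0 : ∀ z ∈ Metric.sphere (0 : ℂ) R, f z ≠ 0 := fun z hz h => by
    have := hlt z hz
    rw [h, zero_sub, norm_neg] at this
    exact lt_irrefl _ this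
  have hslit : ∀ z ∈ Metric.sphere (0 : ℂ) R, f z / g z ∈ Complex.slitPlane := fun z hz => by
    have h1 : f z / g z = 1 + (f z - g z) / g z := by
      field_simp [hg0 z hz]
      ring
    rw [h1]
    apply Complex.mem_slitPlane_of_norm_lt_one
    rw [norm_div, div_lt_one (norm_pos_iff.2 (hg0 z hz))]
    exact hlt z hz
  have hderiv : ∀ z ∈ Metric.sphere (0 : ℂ) R,
      HasDerivWithinAt (fun z => Complex.log (f z / g z)) (logDeriv f z - logDeriv g z)
        (Metric.sphere (0 : ℂ) R) z := fun z hz => by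
    have hfz := (differentiableAt_of_differentiableOn_isOpen hU hf (hsub hz)).hasDerivAt
    have hgz := (differentiableAt_of_differentiableOn_isOpen hU hg (hsub hz)).hasDerivAt
    have h := ((hfz.div hgz (hg0 z hz)).clog (hslit z hz)).hasDerivWithinAt
      (s := Metric.sphere (0 : ℂ) R)
    have heq : (deriv f z * g z - f z * deriv g z) / g z ^ 2 / (f / g) z =
        logDeriv f z - logDeriv g z := by
      have := hf0 z hz
      have := hg0 z hz
      simp only [logDeriv_apply, Pi.div_apply]
      field_simp
    rw [heq] at h
    exact h
  have hint : ∀ {h : ℂ → ℂ}, DifferentiableOn ℂ h U → (∀ z ∈ Metric.sphere (0 : ℂ) R, h z ≠ 0) →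
      CircleIntegrable (logDeriv h) 0 R := fun {h} hh h0 => by
    apply ContinuousOn.circleIntegrable hR
    exact ((hh.deriv hU).continuousOn.mono hsub).div (hh.continuousOn.mono hsub) h0
  have h := circleIntegral.integral_eq_zero_of_hasDerivWithinAt hR hderiv
  rw [circleIntegral.integral_sub (hint hf hf0) (hint hg hg0)] at h
  exact sub_eq_zero.1 h

/-- The argument principle for a polynomial times a nonvanishing analytic function. -/
theorem circleIntegral_logDeriv_eq_card_roots {f g : ℂ → ℂ} {P : Polynomial ℂ} {U : Set ℂ}
    (hU : IsOpen U) {R : ℝ} (hR : 0 < R) (hsub : Metric.closedBall (0 : ℂ) R ⊆ U)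
    (hg : DifferentiableOn ℂ g U) (hg0 : ∀ z ∈ U, g z ≠ 0) (hP : P ≠ 0)
    (hf : ∀ z ∈ U, f z = P.eval z * g z) (hroot : ∀ w ∈ P.roots, ‖w‖ ≠ R) :
    (∮ z in C(0, R), logDeriv f z) =
      2 * Real.pi * Complex.I * ((P.roots.filter (fun w => ‖w‖ < R)).card : ℂ) := by
  classical
  have hsph : Metric.sphere (0 : ℂ) R ⊆ U := Metric.sphere_subset_closedBall.trans hsub
  have hP0 : ∀ z ∈ Metric.sphere (0 : ℂ) R, P.eval z ≠ 0 := fun z hz h =>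
    hroot z ((Polynomial.mem_roots hP).2 h) (by simpa using hz)
  have hlog : Set.EqOn (logDeriv f)
      (fun z => (P.roots.map fun w => (z - w)⁻¹).sum + logDeriv g z) (Metric.sphere (0 : ℂ) R) := by
    intro z hz
    have hev : f =ᶠ[𝓝 z] fun z => P.eval z * g z := by
      filter_upwards [hU.mem_nhds (hsph hz)] with x hx using hf x hx
    have h1 : logDeriv f z = logDeriv (fun z => P.eval z * g z) z := by
      rw [logDeriv_apply, logDeriv_apply, hev.deriv_eq, hev.eq_of_nhds]
    rw [h1, logDeriv_mul z (hP0 z hz) (hg0 z (hsph hz)) P.differentiableAt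
      (differentiableAt_of_differentiableOn_isOpen hU hg (hsph hz))]
    simp only [add_left_inj]
    rw [logDeriv_apply, Polynomial.deriv,
      (IsAlgClosed.splits P).eval_derivative_div_eval_of_ne_zero (hP0 z hz)]
    simp [one_div]
  have hgint : CircleIntegrable (logDeriv g) 0 R := by
    apply ContinuousOn.circleIntegrable hR.le
    exact ((hg.deriv hU).continuousOn.mono hsph).div (hg.continuousOn.mono hsph)
      fun z hz => hg0 z (hsph hz)
  have hgzero : (∮ z in C(0, R), logDeriv g z) = 0 := by
    apply DiffContOnCl.circleIntegral_eq_zero hR.le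
    apply DifferentiableOn.diffContOnCl
    rw [closure_ball _ hR.ne']
    intro z hz
    have := ((hg.deriv hU).div hg hg0) z (hsub hz)
    exact this.mono hsub
  have key : ∀ s : Multiset ℂ, (∀ w ∈ s, ‖w‖ ≠ R) →
      CircleIntegrable (fun z => (s.map fun w => (z - w)⁻¹).sum) 0 R ∧
      (∮ z in C(0, R), (s.map fun w => (z - w)⁻¹).sum) =
        2 * Real.pi * Complex.I * ((s.filter (fun w => ‖w‖ < R)).card : ℂ) := by
    intro s
    induction s using Multiset.induction_on with
    | empty =>
      intro _
      simp [circleIntegral]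
    | cons a s ih =>
      intro h
      obtain ⟨h1, h2⟩ := ih fun w hw => h w (Multiset.mem_cons_of_mem hw)
      have ha := h a (Multiset.mem_cons_self a s)
      have hcont : ContinuousOn (fun z : ℂ => (z - a)⁻¹) (Metric.sphere (0 : ℂ) R) :=
        (by fun_prop : ContinuousOn (fun z : ℂ => z - a) _).inv₀ fun z hz h0 => ha (by
          rw [← sub_eq_zero.1 h0]; simpa using hz)
      have hai := hcont.circleIntegrable hR.le
      simp only [Multiset.map_cons, Multiset.sum_cons]
      refine ⟨hai.add h1, ?_⟩
      rw [circleIntegral.integral_add hai h1, h2, Multiset.filter_cons]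
      by_cases hlt : ‖a‖ < R
      · rw [circleIntegral.integral_sub_inv_of_mem_ball (by simpa using hlt)]
        simp [hlt]
        ring
      · have hgt : R < ‖a‖ := lt_of_le_of_ne (not_lt.1 hlt) (Ne.symm ha)
        have : (∮ z in C(0, R), (z - a)⁻¹) = 0 := by
          apply DiffContOnCl.circleIntegral_eq_zero hR.le
          apply DifferentiableOn.diffContOnCl
          rw [closure_ball _ hR.ne']
          intro z hz
          have hza : z - a ≠ 0 := fun h0 => by
            rw [sub_eq_zero.1 h0] at hz
            simp at hz
            linarith
          exact ((by fun_prop : DifferentiableAt ℂ (fun z : ℂ => z - a) z).inv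
            hza).differentiableWithinAt
        simp [hlt, this]
  rw [circleIntegral.integral_congr hR.le hlog]
  obtain ⟨h1, h2⟩ := key P.roots hroot
  rw [circleIntegral.integral_add h1 hgint, hgzero, h2, add_zero]

theorem Polynomial.analyticOrderAt_eval {P : Polynomial ℂ} (hP : P ≠ 0) (w : ℂ) :
    analyticOrderAt (fun z => P.eval z) w = P.rootMultiplicity w := by
  obtain ⟨q, hq, hdvd⟩ := P.exists_eq_pow_rootMultiplicity_mul_and_not_dvd hP w
  rw [(AnalyticOnNhd.eval_polynomial (A := ℂ) P w (Set.mem_univ _) :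
    AnalyticAt ℂ (fun z => P.eval z) w).analyticOrderAt_eq_natCast]
  refine ⟨fun z => q.eval z, AnalyticOnNhd.eval_polynomial (A := ℂ) q w (Set.mem_univ _), ?_, ?_⟩
  · intro h
    exact hdvd (Polynomial.dvd_iff_isRoot.2 h)
  · refine Eventually.of_forall fun z => ?_
    conv_lhs => rw [hq]
    simp

/-- An analytic function with finitely many zeros in an open set is a polynomial carrying these
zeros times a nonvanishing analytic function. -/
theorem exists_eq_polynomial_mul_of_finite_zeros {U : Set ℂ} (hU : IsOpen U) (s : Finset ℂ) :
    ∀ {f : ℂ → ℂ}, DifferentiableOn ℂ f U → (∀ z ∈ U, f z = 0 → z ∈ s) →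
      ∃ (P : Polynomial ℂ) (g : ℂ → ℂ), P ≠ 0 ∧ DifferentiableOn ℂ g U ∧ (∀ z ∈ U, g z ≠ 0) ∧
        (∀ z ∈ U, f z = P.eval z * g z) ∧ ∀ w ∈ P.roots, w ∈ U := by
  classical
  induction s using Finset.strongInduction with
  | H s ih =>
    intro f hf hs
    by_cases hz : ∀ z ∈ U, f z ≠ 0
    · exact ⟨1, f, one_ne_zero, hf, hz, by simp, by simp⟩
    push Not at hz
    obtain ⟨w, hwU, hw⟩ := hz
    have hfa : AnalyticAt ℂ f w := hf.analyticAt (hU.mem_nhds hwU)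
    have htop : analyticOrderAt f w ≠ ⊤ := by
      intro h
      rw [analyticOrderAt_eq_top] at h
      have h2 : (s : Set ℂ) ∈ 𝓝 w := by
        filter_upwards [h, hU.mem_nhds hwU] with z h1 h2 using hs z h2 h1
      exact (infinite_of_mem_nhds w h2) s.finite_toSet
    obtain ⟨n, hn⟩ := ENat.ne_top_iff_exists.1 htop
    obtain ⟨g₀, hg₀, hg₀w, hfg₀⟩ := hfa.analyticOrderAt_eq_natCast.1 hn.symm
    set g : ℂ → ℂ := fun z => if z = w then g₀ w else f z / (z - w) ^ n with hg
    have hgne : ∀ z, z ≠ w → g z = f z / (z - w) ^ n := fun z hzw => by simp [hg, hzw]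
    have hgev : g =ᶠ[𝓝 w] g₀ := by
      filter_upwards [hfg₀] with z hz
      by_cases hzw : z = w
      · simp [hg, hzw]
      · rw [hgne z hzw, hz, smul_eq_mul, mul_div_cancel_left₀]
        exact pow_ne_zero _ (sub_ne_zero.2 hzw)
    have hfg : ∀ z ∈ U, f z = (z - w) ^ n * g z := by
      intro z _
      by_cases hzw : z = w
      · subst hzw
        rw [hgev.eq_of_nhds]
        simpa using hfg₀.self_of_nhds
      · rw [hgne z hzw, mul_div_cancel₀]
        exact pow_ne_zero _ (sub_ne_zero.2 hzw)
    have hgd : DifferentiableOn ℂ g U := by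
      intro z hz
      apply DifferentiableAt.differentiableWithinAt
      by_cases hzw : z = w
      · subst hzw
        exact hg₀.differentiableAt.congr_of_eventuallyEq hgev
      · have h1 : g =ᶠ[𝓝 z] fun z => f z / (z - w) ^ n := by
          filter_upwards [isOpen_ne.mem_nhds hzw] with x hx using hgne x hx
        refine DifferentiableAt.congr_of_eventuallyEq ?_ h1
        exact (differentiableAt_of_differentiableOn_isOpen hU hf hz).div (by fun_prop)
          (pow_ne_zero _ (sub_ne_zero.2 hzw))
    have hgw : g w ≠ 0 := by rwa [hgev.eq_of_nhds]
    obtain ⟨P, k, hP, hk, hk0, hgP, hroots⟩ := ih (s.erase w) (Finset.erase_ssubset (hs w hwU hw))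
      hgd (fun z hz h0 => Finset.mem_erase.2
        ⟨fun h => hgw (h ▸ h0), hs z hz (by rw [hfg z hz, h0, mul_zero])⟩)
    have hXn : (Polynomial.X - Polynomial.C w) ^ n ≠ 0 :=
      pow_ne_zero _ (Polynomial.X_sub_C_ne_zero w)
    refine ⟨(Polynomial.X - Polynomial.C w) ^ n * P, k, mul_ne_zero hXn hP, hk, hk0, ?_, ?_⟩
    · intro z hz
      rw [hfg z hz, hgP z hz]
      simp [mul_assoc]
    · intro v hv
      rw [Polynomial.roots_mul (mul_ne_zero hXn hP), Multiset.mem_add] at hv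
      rcases hv with hv | hv
      · rw [Polynomial.roots_pow, Polynomial.roots_X_sub_C] at hv
        have := Multiset.mem_of_mem_nsmul hv
        rw [Multiset.mem_singleton] at this
        rwa [this]
      · exact hroots v hv

/-! ### Difference quotients of generating functions at `1` -/

/-- Iterated geometric sums: `iterGeom 0 k z = z ^ k`, and `iterGeom (m + 1) k z` is the sum of
`iterGeom m j z` over `j < k`. It is the `m`-th difference quotient of `z ^ k` at `1`: one has
`iterGeom m k 1 = choose k m` and `iterGeom m k z = choose k m + (z - 1) * iterGeom (m + 1) k z`.
The ring is arbitrary so that one definition serves real numbers, complex numbers and polynomials.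
-/
def iterGeom {R : Type*} [CommSemiring R] : ℕ → ℕ → R → R
  | 0, k, z => z ^ k
  | m + 1, k, z => ∑ j ∈ Finset.range k, iterGeom m j z

section iterGeom

variable {R : Type*}

theorem iterGeom_zero [CommSemiring R] (k : ℕ) (z : R) : iterGeom 0 k z = z ^ k := rfl

theorem iterGeom_succ [CommSemiring R] (m k : ℕ) (z : R) :
    iterGeom (m + 1) k z = ∑ j ∈ Finset.range k, iterGeom m j z := rfl

theorem iterGeom_apply_one [CommSemiring R] (m k : ℕ) :
    iterGeom m k (1 : R) = (k.choose m : R) := by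
  induction m generalizing k with
  | zero => simp [iterGeom_zero]
  | succ m ih =>
    rw [iterGeom_succ]
    induction k with
    | zero => simp
    | succ k ihk =>
      rw [Finset.sum_range_succ, ihk, ih, Nat.choose_succ_succ]
      push_cast
      ring

theorem iterGeom_eq_choose_add [CommRing R] (m k : ℕ) (z : R) :
    iterGeom m k z = (k.choose m : R) + (z - 1) * iterGeom (m + 1) k z := by
  induction m generalizing k with
  | zero =>
    rw [iterGeom_zero, iterGeom_succ]
    simp only [iterGeom_zero]
    rw [mul_comm, geom_sum_mul]
    simp
  | succ m ih =>
    rw [iterGeom_succ (m + 1), iterGeom_succ m, Finset.mul_sum, ← iterGeom_apply_one (R := R),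
      iterGeom_succ, ← Finset.sum_add_distrib]
    refine Finset.sum_congr rfl fun j _ => ?_
    rw [iterGeom_apply_one, ← ih]

theorem ofReal_iterGeom (m k : ℕ) (x : ℝ) :
    ((iterGeom m k x : ℝ) : ℂ) = iterGeom m k (x : ℂ) := by
  induction m generalizing k with
  | zero => simp [iterGeom_zero]
  | succ m ih => simp [iterGeom_succ, ih]

theorem iterGeom_nonneg (m k : ℕ) {x : ℝ} (hx : 0 ≤ x) : 0 ≤ iterGeom m k x := by
  induction m generalizing k with
  | zero => exact pow_nonneg hx k
  | succ m ih => exact Finset.sum_nonneg fun j _ => ih j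

theorem norm_iterGeom_le (m k : ℕ) {z : ℂ} (hz : ‖z‖ ≤ 1) : ‖iterGeom m k z‖ ≤ k.choose m := by
  induction m generalizing k with
  | zero => simpa [iterGeom_zero] using pow_le_one₀ (norm_nonneg z) hz
  | succ m ih =>
    rw [iterGeom_succ, ← iterGeom_apply_one (R := ℝ), iterGeom_succ]
    refine norm_sum_le_of_le _ fun j _ => ?_
    rw [iterGeom_apply_one]
    exact ih j

theorem differentiable_iterGeom (m k : ℕ) : Differentiable ℂ (iterGeom m k : ℂ → ℂ) := by
  induction m generalizing k with
  | zero => exact differentiable_pow k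
  | succ m ih => exact Differentiable.fun_sum fun j _ => ih j

theorem continuous_iterGeom_real (m k : ℕ) : Continuous (iterGeom m k : ℝ → ℝ) := by
  induction m generalizing k with
  | zero => exact continuous_pow k
  | succ m ih => exact continuous_finsetSum _ fun j _ => ih j

end iterGeom

/-- The `m`-th difference quotient at `1` of the generating function of the sequence `a`. For
`m = 0` it is the generating function itself, for `m = 1` the generating function of the tails
`∑ k > j, a k`. -/
noncomputable def tailPGF (a : ℕ → ℝ) (m : ℕ) (z : ℂ) : ℂ := ∑' k, (a k : ℂ) * iterGeom m k z

/-- The `m`-th binomial moment `∑ k, a k * choose k m` of the sequence `a`, that is, its `m`-th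
factorial moment divided by `m!`. -/
noncomputable def factMoment (a : ℕ → ℝ) (m : ℕ) : ℝ := ∑' k, a k * k.choose m

section tailPGF

variable {a : ℕ → ℝ} {m : ℕ}

theorem norm_term_tailPGF_le (ha : ∀ k, 0 ≤ a k) (m k : ℕ) {z : ℂ} (hz : ‖z‖ ≤ 1) :
    ‖(a k : ℂ) * iterGeom m k z‖ ≤ a k * k.choose m := by
  rw [norm_mul, Complex.norm_real, Real.norm_of_nonneg (ha k)]
  exact mul_le_mul_of_nonneg_left (norm_iterGeom_le m k hz) (ha k)

theorem summable_tailPGF (ha : ∀ k, 0 ≤ a k) (hs : Summable fun k => a k * k.choose m) {z : ℂ}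
    (hz : ‖z‖ ≤ 1) : Summable fun k => (a k : ℂ) * iterGeom m k z :=
  Summable.of_norm_bounded hs fun k => norm_term_tailPGF_le ha m k hz

theorem continuousOn_tailPGF (ha : ∀ k, 0 ≤ a k) (hs : Summable fun k => a k * k.choose m) :
    ContinuousOn (tailPGF a m) (Metric.closedBall 0 1) :=
  continuousOn_tsum (fun k => ((differentiable_iterGeom m k).continuous.const_mul _).continuousOn)
    hs fun k z hz => norm_term_tailPGF_le ha m k (by simpa using hz)

theorem differentiableOn_tailPGF (ha : ∀ k, 0 ≤ a k) (hs : Summable fun k => a k * k.choose m) :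
    DifferentiableOn ℂ (tailPGF a m) (Metric.ball 0 1) :=
  Complex.differentiableOn_tsum_of_summable_norm hs
    (fun k => ((differentiable_iterGeom m k).const_mul _).differentiableOn) Metric.isOpen_ball
    fun k z hz => norm_term_tailPGF_le ha m k (by simpa using (Metric.ball_subset_closedBall hz))

theorem tailPGF_apply_one (a : ℕ → ℝ) (m : ℕ) : tailPGF a m 1 = factMoment a m := by
  simp [tailPGF, factMoment, iterGeom_apply_one, Complex.ofReal_tsum]

theorem tailPGF_eq_factMoment_add (ha : ∀ k, 0 ≤ a k) (hs : Summable fun k => a k * k.choose m)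
    (hs' : Summable fun k => a k * k.choose (m + 1)) {z : ℂ} (hz : ‖z‖ ≤ 1) :
    tailPGF a m z = factMoment a m + (z - 1) * tailPGF a (m + 1) z := by
  rw [← tailPGF_apply_one, tailPGF, tailPGF, tailPGF, ← tsum_mul_left, ← Summable.tsum_add
    (summable_tailPGF ha hs (by simp)) ((summable_tailPGF ha hs' hz).mul_left _)]
  refine tsum_congr fun k => ?_
  rw [iterGeom_apply_one, iterGeom_eq_choose_add]
  ring

theorem tendsto_ofReal_nhdsLT_one :
    Tendsto (fun x : ℝ => (x : ℂ)) (𝓝[<] 1) (𝓝[Metric.closedBall 0 1] 1) := by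
  refine tendsto_nhdsWithin_iff.2 ⟨?_, ?_⟩
  · exact (Complex.continuous_ofReal.tendsto' 1 1 (by simp)).mono_left nhdsWithin_le_nhds
  · filter_upwards [Ioo_mem_nhdsLT (show (0 : ℝ) < 1 by norm_num)] with x hx
    simp only [Metric.mem_closedBall, dist_zero_right, Complex.norm_real]
    rw [Real.norm_of_nonneg hx.1.le]
    exact hx.2.le

/-- The binomial moment of order `m + 1` exists as soon as the difference quotient `r` of
`tailPGF a m` has a limit `l` as `x → 1⁻`, and then it equals `l`. Nonnegativity of `a` is
essential: partial sums of the next quotient are bounded by `r`. -/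
theorem factMoment_succ_of_tendsto (ha : ∀ k, 0 ≤ a k) (hs : Summable fun k => a k * k.choose m)
    {r : ℂ → ℂ} {l : ℂ}
    (hr : ∀ᶠ x : ℝ in 𝓝[<] 1, tailPGF a m x = factMoment a m + ((x : ℂ) - 1) * r x)
    (hl : Tendsto (fun x : ℝ => r x) (𝓝[<] 1) (𝓝 l)) :
    (Summable fun k => a k * k.choose (m + 1)) ∧ (factMoment a (m + 1) : ℂ) = l := by
  have hIoo : ∀ᶠ x : ℝ in 𝓝[<] 1, x ∈ Set.Ioo (0 : ℝ) 1 :=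
    Ioo_mem_nhdsLT (show (0 : ℝ) < 1 by norm_num)
  have hsum : Summable fun k => a k * k.choose (m + 1) := by
    refine summable_of_sum_le (c := l.re) (fun k => mul_nonneg (ha k) (by positivity)) fun u => ?_
    have h1 : Tendsto (fun x : ℝ => ∑ k ∈ u, a k * iterGeom (m + 1) k x) (𝓝[<] 1)
        (𝓝 (∑ k ∈ u, a k * k.choose (m + 1))) := by
      refine tendsto_finsetSum _ fun k _ => Tendsto.const_mul _ ?_
      rw [← iterGeom_apply_one (R := ℝ)]
      exact ((continuous_iterGeom_real _ _).tendsto 1).mono_left nhdsWithin_le_nhds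
    have h2 : Tendsto (fun x : ℝ => (r x).re) (𝓝[<] 1) (𝓝 l.re) :=
      (Complex.continuous_re.tendsto l).comp hl
    refine le_of_tendsto_of_tendsto h1 h2 ?_
    filter_upwards [hr, hIoo] with x hx hx01
    have hnorm : ‖(x : ℂ)‖ ≤ 1 := by
      rw [Complex.norm_real, Real.norm_of_nonneg hx01.1.le]
      exact hx01.2.le
    have hre : tailPGF a m x = ((∑' k, a k * iterGeom m k x : ℝ) : ℂ) := by
      rw [Complex.ofReal_tsum, tailPGF]
      exact tsum_congr fun k => by rw [Complex.ofReal_mul, ofReal_iterGeom]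
    have hsx : Summable fun k => a k * iterGeom m k x := by
      have := summable_tailPGF ha hs hnorm
      rw [← Complex.summable_ofReal]
      exact this.congr fun k => by rw [Complex.ofReal_mul, ofReal_iterGeom]
    have hx' : (∑' k, a k * iterGeom m k x) = factMoment a m + (x - 1) * (r x).re := by
      have := congrArg Complex.re (hre.symm.trans hx)
      simpa using this
    have hle : ∑ k ∈ u, (a k * k.choose m - a k * iterGeom m k x) ≤
        factMoment a m - ∑' k, a k * iterGeom m k x := by
      rw [factMoment, ← hs.tsum_sub hsx]
      refine (hs.sub hsx).sum_le_tsum u fun k _ => ?_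
      rw [iterGeom_eq_choose_add]
      have := mul_nonneg (ha k) (iterGeom_nonneg (m + 1) k hx01.1.le)
      nlinarith [hx01.2]
    have heq : ∑ k ∈ u, (a k * k.choose m - a k * iterGeom m k x) =
        (1 - x) * ∑ k ∈ u, a k * iterGeom (m + 1) k x := by
      rw [Finset.mul_sum]
      refine Finset.sum_congr rfl fun k _ => ?_
      rw [iterGeom_eq_choose_add m]
      ring
    -- Multiplied by `1 - x`, both sides are differences of values at `1` and at `x`.
    have hpos : 0 < 1 - x := by linarith [hx01.2]
    refine le_of_mul_le_mul_left ?_ hpos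
    rw [← heq]
    linarith
  refine ⟨hsum, ?_⟩
  have h1 : Tendsto (fun x : ℝ => tailPGF a (m + 1) x) (𝓝[<] 1) (𝓝 (factMoment a (m + 1))) := by
    rw [← tailPGF_apply_one]
    exact Tendsto.comp (continuousOn_tailPGF ha hsum 1 (by simp)) tendsto_ofReal_nhdsLT_one
  refine tendsto_nhds_unique h1 (hl.congr' ?_)
  filter_upwards [hr, hIoo] with x hx hx01
  have hnorm : ‖(x : ℂ)‖ ≤ 1 := by
    rw [Complex.norm_real, Real.norm_of_nonneg hx01.1.le]
    exact hx01.2.le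
  rw [tailPGF_eq_factMoment_add ha hs hsum hnorm] at hx
  have hne : (x : ℂ) - 1 ≠ 0 := sub_ne_zero.2 (by exact_mod_cast hx01.2.ne)
  exact (mul_left_cancel₀ hne (add_left_cancel hx)).symm

end tailPGF

/-! ### The stationary law and its functional equation -/

theorem IsSteadyState.real_eq_of_forall_eq {Ω : Type*} [MeasurableSpace Ω] {P : Measure Ω}
    {X : ℕ → Ω → ℕ} {ν : Measure ℕ} (h : IsSteadyState P X ν) {k : ℕ} {c : ℝ}
    (hc : ∀ l, P.real {ω | X l ω = k} = c) : ν.real {k} = c := by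
  refine tendsto_nhds_unique (h k) ?_
  simp only [hc]
  exact tendsto_const_nhds

section Arrivals

variable {Ω : Type*} [MeasurableSpace Ω] {P : Measure Ω} [IsProbabilityMeasure P] {C : ℕ}
  {lam : ℝ} {H : ℕ → Ω → ℝ} {Q S Y : ℕ → Ω → ℕ}

theorem measurable_poissonMeasure_singleton (lam : ℝ) (k : ℕ) :
    Measurable fun x : ℝ => poissonMeasure (lam * x).toNNReal {k} := by
  simp only [poissonMeasure_singleton]
  fun_prop

/-- The law of the arrivals does not depend on the vehicle, and is a mixture of Poisson laws. -/
theorem IsBulkServiceQueue.arrivals_steadyState (h : IsBulkServiceQueue P C lam H Q S Y)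
    {νY : Measure ℕ} [IsProbabilityMeasure νY] (hY : IsSteadyState P Y νY) (k : ℕ) :
    νY {k} = ∫⁻ ω, poissonMeasure (lam * H 0 ω).toNNReal {k} ∂P := by
  have h1 : ∀ l, P {ω | Y l ω = k} = ∫⁻ ω, poissonMeasure (lam * H 0 ω).toNNReal {k} ∂P := by
    intro l
    have h2 := h.arrivals_poisson l k Set.univ MeasurableSet.univ
    simp only [Set.mem_univ, true_and, Set.ofPred_true, Measure.restrict_univ] at h2
    rw [h2]
    exact ((h.headway_identDistrib (l + 1)).comp
      (measurable_poissonMeasure_singleton lam k)).lintegral_eq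
  have h3 := hY.real_eq_of_forall_eq (k := k)
    (c := (∫⁻ ω, poissonMeasure (lam * H 0 ω).toNNReal {k} ∂P).toReal)
    fun l => by rw [measureReal_def, h1]
  rw [measureReal_def, ENNReal.toReal_eq_toReal_iff' (measure_ne_top _ _)] at h3
  · exact h3
  · rw [← h1 0]
    exact measure_ne_top _ _

/-- A mixture of Poisson laws charges `0`, and it charges `1` unless it is concentrated at `0`. -/
theorem IsBulkServiceQueue.arrivals_pos (h : IsBulkServiceQueue P C lam H Q S Y)
    {νY : Measure ℕ} [IsProbabilityMeasure νY] (hY : IsSteadyState P Y νY) :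
    0 < νY.real {0} ∧ (0 < νY.real {1} ∨ ∀ k, k ≠ 0 → νY.real {k} = 0) := by
  have hmeas : ∀ k, AEMeasurable
      (fun ω => poissonMeasure (lam * H 0 ω).toNNReal {k}) P := fun k =>
    ((measurable_poissonMeasure_singleton lam k).comp (h.measurable_H 0)).aemeasurable
  have hpos : ∀ k, 0 < νY.real {k} ∨
      ∀ᵐ ω ∂P, poissonMeasure (lam * H 0 ω).toNNReal {k} = 0 := by
    intro k
    by_cases h0 : νY {k} = 0
    · right
      rw [h.arrivals_steadyState hY, lintegral_eq_zero_iff' (hmeas k)] at h0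
      exact h0
    · left
      exact ENNReal.toReal_pos h0 (measure_ne_top _ _)
  constructor
  · refine (hpos 0).resolve_right fun h0 => ?_
    obtain ⟨ω, hω⟩ := h0.exists
    rw [poissonMeasure_singleton, ENNReal.ofReal_eq_zero] at hω
    have : 0 < Real.exp (-((lam * H 0 ω).toNNReal : ℝ)) := Real.exp_pos _
    simp only [pow_zero, mul_one, Nat.factorial_zero, Nat.cast_one, div_one] at hω
    linarith
  · refine (hpos 1).imp_right fun h1 k hk => ?_
    have h2 : ∀ᵐ ω ∂P, poissonMeasure (lam * H 0 ω).toNNReal {k} = 0 := by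
      filter_upwards [h1] with ω hω
      have h3 : (lam * H 0 ω).toNNReal = 0 := by
        by_contra hne
        have := poissonMeasure_real_singleton_pos (r := (lam * H 0 ω).toNNReal) 1
          (pos_iff_ne_zero.2 hne)
        rw [measureReal_def, hω] at this
        simp at this
      rw [h3, poissonMeasure_singleton]
      simp [hk]
    rw [measureReal_def, h.arrivals_steadyState hY, lintegral_congr_ae h2]
    simp

end Arrivals

section Stationary

/-- One step of the queue recursion, as a function of `((queue, space), arrivals)`; the
subtraction is truncated. -/
def lindleyMap (t : (ℕ × ℕ) × ℕ) : ℕ := (t.1.1 - t.1.2) + t.2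

/-- Because the space is at most `C`, a given new queue length `k` arises from finitely many
triples. -/
theorem measureReal_lindleyMap_preimage (C k : ℕ) (ρ : Measure ((ℕ × ℕ) × ℕ)) [IsFiniteMeasure ρ]
    (hρ : ∀ᵐ t ∂ρ, t.1.2 ≤ C) :
    ρ.real (lindleyMap ⁻¹' {k}) = ∑ t ∈ ((Finset.range (k + C + 1) ×ˢ Finset.range (C + 1)) ×ˢ
      Finset.range (k + 1)).filter (fun t => lindleyMap t = k), ρ.real {t} := by
  rw [sum_measureReal_singleton]
  refine measureReal_congr (eventuallyEq_set.2 ?_)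
  filter_upwards [hρ] with t ht
  obtain ⟨⟨a, b⟩, c⟩ := t
  rw [Finset.mem_coe]
  simp only [Finset.mem_filter, Finset.mem_product, Finset.mem_range, Set.mem_preimage,
    Set.mem_singleton_iff]
  simp only [lindleyMap] at *
  constructor
  · intro h
    refine ⟨⟨⟨?_, ?_⟩, ?_⟩, h⟩ <;> omega
  · exact fun h => h.2

variable {Ω : Type*} [MeasurableSpace Ω] {P : Measure Ω} {C : ℕ}
  {lam : ℝ} {H : ℕ → Ω → ℝ} {Q S Y : ℕ → Ω → ℕ}

theorem IsBulkServiceQueue.space_steadyState_le (h : IsBulkServiceQueue P C lam H Q S Y)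
    {νS : Measure ℕ} [IsProbabilityMeasure νS] (hS : IsSteadyState P S νS) :
    ∀ᵐ b ∂νS, b ≤ C := by
  rw [ae_iff_of_countable]
  intro b hb
  by_contra hlt
  apply hb
  have h0 := hS.real_eq_of_forall_eq (k := b) (c := 0) fun l => by
    have : {ω | S l ω = b} = ∅ := by
      ext ω
      have := h.space_le l ω
      simp only [Set.mem_ofPred_eq, Set.mem_empty_iff_false, iff_false]
      omega
    simp [this]
  rwa [measureReal_eq_zero_iff] at h0

/-- The steady-state law of the queue is invariant under one step with independent space and
arrivals. -/
theorem IsBulkServiceQueue.map_lindleyMap [IsProbabilityMeasure P]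
    (h : IsBulkServiceQueue P C lam H Q S Y)
    {νQ νS νY : Measure ℕ} [IsProbabilityMeasure νQ] [IsProbabilityMeasure νS]
    [IsProbabilityMeasure νY] (hQ : IsSteadyState P Q νQ) (hS : IsSteadyState P S νS)
    (hY : IsSteadyState P Y νY) :
    ((νQ.prod νS).prod νY).map lindleyMap = νQ := by
  have hmQ := h.measurable_Q
  have hmS := h.measurable_S
  have hmY := h.measurable_Y
  have hsingle : ∀ (μ₁ μ₂ μ₃ : Measure ℕ) [IsProbabilityMeasure μ₁] [IsProbabilityMeasure μ₂]
      [IsProbabilityMeasure μ₃] (t : (ℕ × ℕ) × ℕ), ((μ₁.prod μ₂).prod μ₃).real {t} =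
        μ₁.real {t.1.1} * μ₂.real {t.1.2} * μ₃.real {t.2} := by
    intro μ₁ μ₂ μ₃ _ _ _ t
    obtain ⟨⟨a, b⟩, c⟩ := t
    rw [← Set.singleton_prod_singleton, ← Set.singleton_prod_singleton, measureReal_prod_prod,
      measureReal_prod_prod]
  have hlaw : ∀ l, P.map (fun ω => ((Q l ω, S l ω), Y l ω)) =
      ((P.map (Q l)).prod (P.map (S l))).prod (P.map (Y l)) := by
    intro l
    have hm : ∀ i, Measurable (![Q l, S l, Y l] i) := by
      intro i
      fin_cases i
      · exact hmQ l
      · exact hmS l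
      · exact hmY l
    have h1 : IndepFun (Q l) (S l) P :=
      (h.indep l).indepFun (i := 0) (j := 1) (by decide)
    have h2 : IndepFun (fun ω => (Q l ω, S l ω)) (Y l) P :=
      (h.indep l).indepFun_prodMk hm 0 1 2 (by decide) (by decide)
    rw [(indepFun_iff_map_prod_eq_prod_map_map ((hmQ l).prodMk (hmS l)).aemeasurable
      (hmY l).aemeasurable).1 h2, (indepFun_iff_map_prod_eq_prod_map_map (hmQ l).aemeasurable
      (hmS l).aemeasurable).1 h1]
  have hmeas : Measurable lindleyMap := measurable_of_countable _
  refine Measure.ext_of_singleton fun k => ?_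
  rw [← ENNReal.toReal_eq_toReal_iff' (measure_ne_top _ _) (measure_ne_top _ _),
    ← measureReal_def, ← measureReal_def, map_measureReal_apply hmeas (measurableSet_singleton k),
    measureReal_lindleyMap_preimage C k]
  swap
  · have h1 := h.space_steadyState_le hS
    have h2 := Measure.quasiMeasurePreserving_snd (μ := νQ) (ν := νS)
    exact (Measure.quasiMeasurePreserving_fst (μ := νQ.prod νS) (ν := νY)).ae (h2.ae h1)
  refine tendsto_nhds_unique ?_ ((hQ k).comp (tendsto_add_atTop_nat 1))
  have hstep : ∀ l, P.real {ω | Q (l + 1) ω = k} =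
      ∑ t ∈ ((Finset.range (k + C + 1) ×ˢ Finset.range (C + 1)) ×ˢ
        Finset.range (k + 1)).filter (fun t => lindleyMap t = k),
        P.real {ω | Q l ω = t.1.1} * P.real {ω | S l ω = t.1.2} * P.real {ω | Y l ω = t.2} := by
    intro l
    have hm : Measurable fun ω => ((Q l ω, S l ω), Y l ω) :=
      ((hmQ l).prodMk (hmS l)).prodMk (hmY l)
    have h1 : {ω | Q (l + 1) ω = k} =
        (fun ω => ((Q l ω, S l ω), Y l ω)) ⁻¹' (lindleyMap ⁻¹' {k}) := by
      ext ω
      simp [lindleyMap, h.queue_succ]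
    rw [h1, ← map_measureReal_apply hm (hmeas (measurableSet_singleton k)),
      measureReal_lindleyMap_preimage C k]
    · refine Finset.sum_congr rfl fun t _ => ?_
      have := Measure.isProbabilityMeasure_map (μ := P) (hmQ l).aemeasurable
      have := Measure.isProbabilityMeasure_map (μ := P) (hmS l).aemeasurable
      have := Measure.isProbabilityMeasure_map (μ := P) (hmY l).aemeasurable
      rw [hlaw, hsingle, map_measureReal_apply (hmQ l) (measurableSet_singleton _),
        map_measureReal_apply (hmS l) (measurableSet_singleton _),
        map_measureReal_apply (hmY l) (measurableSet_singleton _)]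
      rfl
    · rw [ae_map_iff hm.aemeasurable (Set.to_countable _).measurableSet]
      exact Eventually.of_forall fun ω => h.space_le l ω
  simp only [Function.comp_def, hstep]
  refine tendsto_finsetSum _ fun t _ => ?_
  rw [hsingle]
  exact ((hQ _).mul (hS _)).mul (hY _)

end Stationary

section PGF

theorem integrable_pow {α : Type*} [MeasurableSpace α] [Countable α] [MeasurableSingletonClass α]
    (ν : Measure α) [IsFiniteMeasure ν] (f : α → ℕ) {z : ℂ} (hz : ‖z‖ ≤ 1) :
    Integrable (fun k => z ^ f k) ν :=
  Integrable.of_bound (measurable_of_countable _).aestronglyMeasurable 1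
    (Eventually.of_forall fun k => by simpa using pow_le_one₀ (norm_nonneg z) hz)

theorem lawPGF_eq_integral (ν : Measure ℕ) [IsFiniteMeasure ν] {z : ℂ} (hz : ‖z‖ ≤ 1) :
    lawPGF ν z = ∫ k, z ^ k ∂ν := by
  rw [integral_countable (integrable_pow ν (fun k => k) hz), lawPGF]
  simp

theorem integral_eq_sum_of_ae_le {ν : Measure ℕ} [IsFiniteMeasure ν] {C : ℕ}
    (hν : ∀ᵐ b ∂ν, b ≤ C) {E : Type*} [NormedAddCommGroup E] [NormedSpace ℝ E] [CompleteSpace E]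
    (f : ℕ → E) :
    Integrable f ν ∧ ∫ b, f b ∂ν = ∑ b ∈ Finset.range (C + 1), ν.real {b} • f b := by
  have hset : ν.restrict (Finset.range (C + 1) : Finset ℕ) = ν := by
    apply Measure.restrict_eq_self_of_ae_mem
    filter_upwards [hν] with b hb
    simp
    omega
  have hint : IntegrableOn f (Finset.range (C + 1) : Finset ℕ) ν := by
    exact IntegrableOn.finset
  refine ⟨by rwa [IntegrableOn, hset] at hint, ?_⟩
  conv_lhs => rw [← hset]
  exact setIntegral_finset _ hint

/-- The polynomial `M` for which `(z - 1) M(z)` collects the contribution of the states `a < b`,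
in which the space `b` exceeds the queue `a`. -/
noncomputable def boundaryPoly (C : ℕ) (νQ νS : Measure ℕ) : Polynomial ℂ :=
  ∑ b ∈ Finset.range (C + 1), ∑ a ∈ Finset.range b,
    Polynomial.C ((νQ.real {a} : ℂ) * νS.real {b}) *
      (Polynomial.X ^ (C - b + a) * ∑ j ∈ Finset.range (b - a), Polynomial.X ^ j)

theorem natDegree_boundaryPoly_le (C : ℕ) (νQ νS : Measure ℕ) :
    (boundaryPoly C νQ νS).natDegree ≤ C - 1 := by
  refine Polynomial.natDegree_sum_le_of_forall_le _ _ fun b hb => ?_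
  refine Polynomial.natDegree_sum_le_of_forall_le _ _ fun a ha => ?_
  rw [Finset.mem_range] at ha hb
  refine (Polynomial.natDegree_C_mul_le _ _).trans ?_
  refine Polynomial.natDegree_mul_le.trans ?_
  have h1 : (∑ j ∈ Finset.range (b - a), (Polynomial.X : Polynomial ℂ) ^ j).natDegree ≤
      b - a - 1 := by
    refine Polynomial.natDegree_sum_le_of_forall_le _ _ fun j hj => ?_
    rw [Finset.mem_range] at hj
    rw [Polynomial.natDegree_X_pow]
    omega
  rw [Polynomial.natDegree_X_pow]
  omega

theorem sub_one_mul_eval_boundaryPoly (C : ℕ) (νQ νS : Measure ℕ) (z : ℂ) :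
    (z - 1) * (boundaryPoly C νQ νS).eval z = ∑ b ∈ Finset.range (C + 1), ∑ a ∈ Finset.range b,
      ((νQ.real {a} : ℂ) * νS.real {b}) * (z ^ C - z ^ (C - b + a)) := by
  simp only [boundaryPoly, Polynomial.eval_finsetSum, Finset.mul_sum, Polynomial.eval_mul,
    Polynomial.eval_C, Polynomial.eval_pow, Polynomial.eval_X]
  refine Finset.sum_congr rfl fun b hb => Finset.sum_congr rfl fun a ha => ?_
  rw [Finset.mem_range] at ha hb
  have h1 : z ^ C = z ^ (C - b + a) * z ^ (b - a) := by
    rw [← pow_add]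
    congr 1
    omega
  simp only [← Finset.mul_sum]
  rw [h1]
  have := geom_sum_mul z (b - a)
  linear_combination ((νQ.real {a} : ℂ) * νS.real {b}) * z ^ (C - b + a) * this

/-- The functional equation of the stationary queue. It comes from
`z ^ C * z ^ (a - b) = z ^ a * z ^ (C - b)` for `b ≤ a`, with a correction term for `a < b`. -/
theorem lawPGF_mul_eq {C : ℕ} {νQ νS νY : Measure ℕ} [IsProbabilityMeasure νQ]
    [IsProbabilityMeasure νS] [IsProbabilityMeasure νY]
    (hstat : ((νQ.prod νS).prod νY).map lindleyMap = νQ) (hS : ∀ᵐ b ∂νS, b ≤ C) {z : ℂ}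
    (hz : ‖z‖ ≤ 1) :
    lawPGF νQ z * (z ^ C - lawPGF νY z *
        ∑ u ∈ Finset.range (C + 1), (νS.real {u} : ℂ) * z ^ (C - u)) =
      lawPGF νY z * ((z - 1) * (boundaryPoly C νQ νS).eval z) := by
  have h1 : lawPGF νQ z = (∫ t, z ^ (t.1 - t.2) ∂(νQ.prod νS)) * lawPGF νY z := by
    conv_lhs => rw [lawPGF_eq_integral νQ hz, ← hstat]
    rw [integral_map (measurable_of_countable _).aemeasurable
      (measurable_of_countable _).aestronglyMeasurable, lawPGF_eq_integral νY hz]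
    simp only [lindleyMap, pow_add]
    exact integral_prod_mul (fun t : ℕ × ℕ => z ^ (t.1 - t.2)) (fun c => z ^ c)
  have h2 : ∀ᵐ t ∂(νQ.prod νS), t.2 ≤ C := Measure.quasiMeasurePreserving_snd.ae hS
  set δ : ℕ → ℕ → ℂ := fun b a => if a < b then z ^ C - z ^ (C - b + a) else 0 with hδ
  have hδb : ∀ t : ℕ × ℕ, ‖δ t.2 t.1‖ ≤ 2 := fun t => by
    simp only [hδ]
    split_ifs
    · refine (norm_sub_le _ _).trans ?_
      rw [norm_pow, norm_pow]
      have h1 := pow_le_one₀ (n := C) (norm_nonneg z) hz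
      have h2 := pow_le_one₀ (n := C - t.2 + t.1) (norm_nonneg z) hz
      linarith
    · simp
  have hδi : Integrable (fun t : ℕ × ℕ => δ t.2 t.1) (νQ.prod νS) :=
    Integrable.of_bound (measurable_of_countable _).aestronglyMeasurable 2
      (Eventually.of_forall hδb)
  have h3 : z ^ C * (∫ t, z ^ (t.1 - t.2) ∂(νQ.prod νS)) =
      (∫ a, z ^ a ∂νQ) * (∫ b, z ^ (C - b) ∂νS) + ∫ t, δ t.2 t.1 ∂(νQ.prod νS) := by
    rw [← integral_prod_mul, ← integral_const_mul, ← integral_add _ hδi]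
    · refine integral_congr_ae ?_
      filter_upwards [h2] with t ht
      simp only [hδ]
      split_ifs with h
      · rw [Nat.sub_eq_zero_of_le h.le, add_comm (C - t.2), pow_add]
        ring
      · rw [← pow_add, ← pow_add, add_zero]
        congr 1
        omega
    · simp only [← pow_add]
      exact integrable_pow _ _ hz
  have h4 : ∫ t, δ t.2 t.1 ∂(νQ.prod νS) = (z - 1) * (boundaryPoly C νQ νS).eval z := by
    rw [integral_prod_symm _ hδi, (integral_eq_sum_of_ae_le hS _).2,
      sub_one_mul_eval_boundaryPoly]
    refine Finset.sum_congr rfl fun b _ => ?_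
    have h5 : ∫ a, δ b a ∂νQ = ∫ a in (Finset.range b : Finset ℕ), δ b a ∂νQ := by
      refine (setIntegral_eq_integral_of_forall_compl_eq_zero fun a ha => ?_).symm
      simp only [Finset.coe_range, Set.mem_Iio] at ha
      simp [hδ, ha]
    rw [h5, setIntegral_finset _ IntegrableOn.finset, Finset.smul_sum]
    refine Finset.sum_congr rfl fun a ha => ?_
    rw [Finset.mem_range] at ha
    simp only [hδ, if_pos ha, Complex.real_smul]
    ring
  have h6 : ∫ b, z ^ (C - b) ∂νS =
      ∑ u ∈ Finset.range (C + 1), (νS.real {u} : ℂ) * z ^ (C - u) := by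
    rw [(integral_eq_sum_of_ae_le hS _).2]
    simp
  rw [← lawPGF_eq_integral νQ hz, h6, h4] at h3
  linear_combination (z ^ C) * h1 + lawPGF νY z * h3

end PGF

/-! ### Truncated denominators -/

theorem eval_iterGeom_X (m k : ℕ) (z : ℂ) :
    (iterGeom m k (Polynomial.X : Polynomial ℂ)).eval z = iterGeom m k z := by
  induction m generalizing k with
  | zero => simp [iterGeom_zero]
  | succ m ih => simp [iterGeom_succ, Polynomial.eval_finsetSum, ih]

/-- The `m`-th difference quotient at `1` of `S*(z) = ∑ u ≤ C, s u * z ^ (C - u)`, the generating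
function of the occupied space `C - S`; `spaceTail C s 0` is `S*`. -/
noncomputable def spaceTail {R : Type*} [CommSemiring R] [Algebra ℝ R] (C : ℕ) (s : ℕ → ℝ) (m : ℕ)
    (z : R) : R :=
  ∑ u ∈ Finset.range (C + 1), algebraMap ℝ R (s u) * iterGeom m (C - u) z

/-- The `m`-th binomial moment of the occupied space `C - S`. -/
noncomputable def spaceMoment (C : ℕ) (s : ℕ → ℝ) (m : ℕ) : ℝ :=
  ∑ u ∈ Finset.range (C + 1), s u * (C - u).choose m

section spaceTail

variable {C : ℕ} {s : ℕ → ℝ} {m : ℕ}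

theorem spaceTail_apply_one {R : Type*} [CommSemiring R] [Algebra ℝ R] :
    spaceTail C s m (1 : R) = algebraMap ℝ R (spaceMoment C s m) := by
  simp [spaceTail, spaceMoment, iterGeom_apply_one]

theorem spaceTail_eq_spaceMoment_add {R : Type*} [CommRing R] [Algebra ℝ R] (z : R) :
    spaceTail C s m z = algebraMap ℝ R (spaceMoment C s m) + (z - 1) * spaceTail C s (m + 1) z := by
  rw [← spaceTail_apply_one, spaceTail, spaceTail, spaceTail, Finset.mul_sum,
    ← Finset.sum_add_distrib]
  refine Finset.sum_congr rfl fun u _ => ?_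
  rw [iterGeom_apply_one, iterGeom_eq_choose_add]
  ring

theorem eval_spaceTail_X (z : ℂ) :
    (spaceTail C s m (Polynomial.X : Polynomial ℂ)).eval z = spaceTail C s m z := by
  simp [spaceTail, Polynomial.eval_finsetSum, eval_iterGeom_X,
    IsScalarTower.algebraMap_apply ℝ ℂ (Polynomial ℂ)]

theorem differentiable_spaceTail : Differentiable ℂ (spaceTail C s m : ℂ → ℂ) :=
  Differentiable.fun_sum fun _ _ => (differentiable_iterGeom m _).const_mul _

theorem continuous_spaceTail_real : Continuous (spaceTail C s m : ℝ → ℝ) :=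
  continuous_finsetSum _ fun _ _ => (continuous_iterGeom_real m _).const_mul _

theorem norm_spaceTail_zero_le (hs : ∀ u, 0 ≤ s u) (z : ℂ) :
    ‖spaceTail C s 0 z‖ ≤ spaceTail C s 0 ‖z‖ := by
  refine norm_sum_le_of_le _ fun u _ => ?_
  simp [iterGeom_zero, abs_of_nonneg (hs u)]

theorem norm_spaceTail_zero_le_one (hs : ∀ u, 0 ≤ s u)
    (hs1 : ∑ u ∈ Finset.range (C + 1), s u = 1) {z : ℂ} (hz : ‖z‖ ≤ 1) :
    ‖spaceTail C s 0 z‖ ≤ 1 := by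
  rw [← hs1]
  refine norm_sum_le_of_le _ fun u _ => ?_
  simp only [iterGeom_zero, Complex.coe_algebraMap, norm_mul, Complex.norm_real, norm_pow,
    Real.norm_of_nonneg (hs u)]
  exact mul_le_of_le_one_right (hs u) (pow_le_one₀ (norm_nonneg z) hz)

end spaceTail

/-- The quotient `E(z)` of `z ^ C - Y(z) S*(z)` by `z - 1`, written through difference quotients
at `1`, which makes sense at `z = 1` too. -/
noncomputable def reducedDen (C : ℕ) (s y : ℕ → ℝ) (z : ℂ) : ℂ :=
  iterGeom 1 C z - tailPGF y 1 z * spaceTail C s 0 z - spaceTail C s 1 z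

/-- The analogue of `reducedDen` when the arrival numbers from `N` on are replaced by `0`. This
keeps the total mass `1` and does not increase the mean, and makes `truncDen` a polynomial. -/
noncomputable def truncDen {R : Type*} [CommRing R] [Algebra ℝ R] (C : ℕ) (s y : ℕ → ℝ) (N : ℕ)
    (z : R) : R :=
  iterGeom 1 C z - (∑ k ∈ Finset.range N, algebraMap ℝ R (y k) * iterGeom 1 k z) *
    spaceTail C s 0 z - spaceTail C s 1 z

section truncDen

variable {C : ℕ} {s y : ℕ → ℝ} {N : ℕ}

theorem eval_truncDen_X (z : ℂ) :
    (truncDen C s y N (Polynomial.X : Polynomial ℂ)).eval z = truncDen C s y N z := by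
  simp [truncDen, eval_spaceTail_X, eval_iterGeom_X, Polynomial.eval_finsetSum,
    IsScalarTower.algebraMap_apply ℝ ℂ (Polynomial ℂ)]

theorem sub_one_mul_truncDen {R : Type*} [CommRing R] [Algebra ℝ R]
    (hs1 : ∑ u ∈ Finset.range (C + 1), s u = 1) (z : R) :
    (z - 1) * truncDen C s y N z = z ^ C - (algebraMap ℝ R (1 - ∑ k ∈ Finset.range N, y k) +
      ∑ k ∈ Finset.range N, algebraMap ℝ R (y k) * z ^ k) * spaceTail C s 0 z := by
  have h0 : spaceMoment C s 0 = 1 := by simpa [spaceMoment] using hs1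
  have h1 := spaceTail_eq_spaceMoment_add (C := C) (s := s) (m := 0) z
  have h2 : z ^ C = 1 + (z - 1) * iterGeom 1 C z := by
    simpa [iterGeom_zero] using iterGeom_eq_choose_add 0 C z
  have h3 : ∑ k ∈ Finset.range N, algebraMap ℝ R (y k) * z ^ k =
      algebraMap ℝ R (∑ k ∈ Finset.range N, y k) +
        (z - 1) * ∑ k ∈ Finset.range N, algebraMap ℝ R (y k) * iterGeom 1 k z := by
    rw [map_sum, Finset.mul_sum, ← Finset.sum_add_distrib]
    refine Finset.sum_congr rfl fun k _ => ?_
    have := iterGeom_eq_choose_add 0 k z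
    rw [iterGeom_zero] at this
    rw [this]
    simp
    ring
  rw [h0, map_one] at h1
  rw [h2, h3, truncDen, map_sub, map_one]
  linear_combination h1

theorem truncDen_apply_one {R : Type*} [CommRing R] [Algebra ℝ R]
    (hs1 : ∑ u ∈ Finset.range (C + 1), s u = 1) :
    truncDen C s y N (1 : R) = algebraMap ℝ R
      (C - ∑ k ∈ Finset.range N, y k * k - spaceMoment C s 1) := by
  have h0 : spaceMoment C s 0 = 1 := by simpa [spaceMoment] using hs1
  simp [truncDen, spaceTail_apply_one, h0, iterGeom_apply_one]

theorem continuous_truncDen_real : Continuous (truncDen C s y N : ℝ → ℝ) := by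
  unfold truncDen
  refine ((continuous_iterGeom_real 1 C).sub (Continuous.mul ?_ continuous_spaceTail_real)).sub
    continuous_spaceTail_real
  exact continuous_finsetSum _ fun _ _ => (continuous_iterGeom_real 1 _).const_mul _

/-- For `r > 1` close to `1` the positive value of `truncDen` at `r` says that `z ^ C` dominates
on `‖z‖ = r`, so that `(z - 1) * truncDen` has `C` roots in `‖z‖ < r`; one of them is `1`. -/
theorem card_roots_truncDen (hs : ∀ u, 0 ≤ s u) (hs1 : ∑ u ∈ Finset.range (C + 1), s u = 1)
    (hy : ∀ k, 0 ≤ y k) (hy1 : ∑ k ∈ Finset.range N, y k ≤ 1)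
    (hpos : 0 < C - ∑ k ∈ Finset.range N, y k * k - spaceMoment C s 1) :
    ((truncDen C s y N (Polynomial.X : Polynomial ℂ)).roots.filter (fun w => ‖w‖ ≤ 1)).card =
      C - 1 := by
  classical
  set E := truncDen C s y N (Polynomial.X : Polynomial ℂ) with hE
  have hE0 : E ≠ 0 := fun h => by
    have h1 := eval_truncDen_X (C := C) (s := s) (y := y) (N := N) 1
    rw [← hE, h, truncDen_apply_one hs1, Polynomial.eval_zero] at h1
    simp only [Complex.coe_algebraMap] at h1
    exact hpos.ne (by exact_mod_cast h1)
  set p := (Polynomial.X - Polynomial.C 1) * E with hp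
  have hp0 : p ≠ 0 := mul_ne_zero (Polynomial.X_sub_C_ne_zero 1) hE0
  have hpe : ∀ z : ℂ, p.eval z = z ^ C - (algebraMap ℝ ℂ (1 - ∑ k ∈ Finset.range N, y k) +
      ∑ k ∈ Finset.range N, algebraMap ℝ ℂ (y k) * z ^ k) * spaceTail C s 0 z := fun z => by
    rw [← sub_one_mul_truncDen hs1, hp, hE, Polynomial.eval_mul, eval_truncDen_X]
    simp
  have ev1 : ∀ᶠ r : ℝ in 𝓝[>] 1, 0 < truncDen C s y N r := by
    refine (continuous_truncDen_real.tendsto 1).mono_left nhdsWithin_le_nhds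
      |>.eventually (lt_mem_nhds ?_)
    rw [truncDen_apply_one hs1]
    exact hpos
  -- There are finitely many roots, so `r` can be chosen with no root in `1 < ‖w‖ < r`.
  have ev2 : ∀ᶠ r : ℝ in 𝓝[>] 1, ∀ w ∈ E.roots.toFinset, ‖w‖ < r ↔ ‖w‖ ≤ 1 := by
    rw [Finset.eventually_all]
    intro w _
    by_cases h : ‖w‖ ≤ 1
    · filter_upwards [self_mem_nhdsWithin] with r hr
      exact ⟨fun _ => h, fun h => h.trans_lt hr⟩
    · filter_upwards [Ioo_mem_nhdsGT (not_le.1 h)] with r hr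
      exact ⟨fun h' => absurd (h'.trans hr.2) (lt_irrefl _), fun h' => absurd h' h⟩
  obtain ⟨r, ⟨hr1, hr2⟩, hr3 : 1 < r⟩ := ((ev1.and ev2).and self_mem_nhdsWithin).exists
  have hr0 : 0 < r := by linarith
  have hlt : ∀ z ∈ Metric.sphere (0 : ℂ) r, ‖p.eval z - z ^ C‖ < ‖z ^ C‖ := by
    intro z hz
    have hzr : ‖z‖ = r := by simpa using hz
    rw [hpe, sub_sub_cancel_left, norm_neg, norm_mul, norm_pow, hzr]
    have h1 := sub_one_mul_truncDen (y := y) (N := N) hs1 r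
    have h2 : 0 < (r - 1) * truncDen C s y N r := mul_pos (by linarith) hr1
    have h3 : ‖algebraMap ℝ ℂ (1 - ∑ k ∈ Finset.range N, y k) +
        ∑ k ∈ Finset.range N, algebraMap ℝ ℂ (y k) * z ^ k‖ ≤
        (1 - ∑ k ∈ Finset.range N, y k) + ∑ k ∈ Finset.range N, y k * r ^ k := by
      refine (norm_add_le _ _).trans (add_le_add ?_ (norm_sum_le_of_le _ fun k _ => ?_))
      · rw [Complex.coe_algebraMap, Complex.norm_real, Real.norm_of_nonneg (by linarith)]
      · rw [Complex.coe_algebraMap, norm_mul, Complex.norm_real, Real.norm_of_nonneg (hy k),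
          norm_pow, hzr]
    have h4 := norm_spaceTail_zero_le (C := C) hs z
    rw [hzr] at h4
    have h5 := mul_le_mul h3 h4 (norm_nonneg _) ((norm_nonneg _).trans h3)
    simp only [Algebra.algebraMap_self, RingHom.id_apply] at h1
    linarith
  have hrouche := circleIntegral_logDeriv_eq_of_norm_sub_lt (f := fun z => p.eval z)
    (g := fun z => z ^ C) isOpen_univ hr0.le (Set.subset_univ _)
    p.differentiable.differentiableOn (differentiable_pow C).differentiableOn hlt
  have hsph : ∀ w ∈ p.roots, ‖w‖ ≠ r := fun w hw h => by
    have h1 := hlt w (by simpa using h)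
    rw [(Polynomial.mem_roots hp0).1 hw, zero_sub, norm_neg] at h1
    exact lt_irrefl _ h1
  rw [circleIntegral_logDeriv_eq_card_roots (g := fun _ => 1) isOpen_univ hr0 (Set.subset_univ _)
      (differentiableOn_const _) (by simp) hp0 (by simp) hsph,
    circleIntegral_logDeriv_eq_card_roots (g := fun _ => 1) (P := Polynomial.X ^ C) isOpen_univ hr0
      (Set.subset_univ _) (differentiableOn_const _) (by simp)
      (pow_ne_zero _ Polynomial.X_ne_zero) (by simp) ?_] at hrouche
  swap
  · intro w hw
    rw [Polynomial.roots_pow, Polynomial.roots_X] at hw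
    have := Multiset.mem_of_mem_nsmul hw
    rw [Multiset.mem_singleton] at this
    rw [this, norm_zero]
    exact hr0.ne
  have h2 := mul_left_cancel₀ Complex.two_pi_I_ne_zero hrouche
  have h3 : (p.roots.filter (fun w => ‖w‖ < r)).card =
      ((Polynomial.X ^ C : Polynomial ℂ).roots.filter (fun w => ‖w‖ < r)).card := by
    exact_mod_cast h2
  have h4 : (Multiset.filter (fun w : ℂ => ‖w‖ < r) (C • {0})).card = C := by
    rw [Multiset.filter_eq_self.2, Multiset.card_nsmul, Multiset.card_singleton,
      mul_one]
    intro w hw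
    have := Multiset.mem_of_mem_nsmul hw
    rw [Multiset.mem_singleton] at this
    rwa [this, norm_zero]
  rw [Polynomial.roots_pow, Polynomial.roots_X, h4, hp,
    Polynomial.roots_mul hp0, Polynomial.roots_X_sub_C, Multiset.filter_add, Multiset.card_add,
    Multiset.filter_singleton, if_pos (by simpa using hr3), Multiset.card_singleton,
    Multiset.filter_congr (fun w hw => hr2 w (Multiset.mem_toFinset.2 hw))] at h3
  omega

end truncDen

/-! ### Zeros of the reduced denominator -/

theorem tailPGF_zero_apply_zero (y : ℕ → ℝ) : tailPGF y 0 0 = y 0 := by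
  rw [tailPGF, tsum_eq_single 0]
  · simp [iterGeom_zero]
  · intro k hk
    simp [iterGeom_zero, hk]

section reducedDen

variable {C : ℕ} {s y : ℕ → ℝ}

theorem sub_one_mul_reducedDen (hs1 : ∑ u ∈ Finset.range (C + 1), s u = 1) (hy : ∀ k, 0 ≤ y k)
    (hy0 : HasSum y 1) (hy1 : Summable fun k => y k * k) {z : ℂ} (hz : ‖z‖ ≤ 1) :
    (z - 1) * reducedDen C s y z = z ^ C - tailPGF y 0 z * spaceTail C s 0 z := by
  have h0 : spaceMoment C s 0 = 1 := by simpa [spaceMoment] using hs1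
  have h1 := spaceTail_eq_spaceMoment_add (C := C) (s := s) (m := 0) z
  have h2 : z ^ C = 1 + (z - 1) * iterGeom 1 C z := by
    simpa [iterGeom_zero] using iterGeom_eq_choose_add 0 C z
  have h3 := tailPGF_eq_factMoment_add (m := 0) hy (by simpa using hy0.summable)
    (by simpa using hy1) hz
  have h4 : factMoment y 0 = 1 := by simpa [factMoment] using hy0.tsum_eq
  rw [h4, Complex.ofReal_one] at h3
  rw [h0, map_one] at h1
  rw [h2, h3, reducedDen]
  linear_combination h1

theorem reducedDen_apply_one (hs1 : ∑ u ∈ Finset.range (C + 1), s u = 1) :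
    reducedDen C s y 1 = ((C - factMoment y 1 - spaceMoment C s 1 : ℝ) : ℂ) := by
  have h0 : spaceMoment C s 0 = 1 := by simpa [spaceMoment] using hs1
  simp [reducedDen, spaceTail_apply_one, h0, iterGeom_apply_one, tailPGF_apply_one]

theorem continuousOn_reducedDen (hy : ∀ k, 0 ≤ y k) (hy1 : Summable fun k => y k * k) :
    ContinuousOn (reducedDen C s y) (Metric.closedBall 0 1) :=
  ((differentiable_iterGeom 1 C).continuous.continuousOn.sub
    ((continuousOn_tailPGF hy (by simpa using hy1)).mul
      differentiable_spaceTail.continuous.continuousOn)).sub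
    differentiable_spaceTail.continuous.continuousOn

theorem differentiableOn_reducedDen (hy : ∀ k, 0 ≤ y k) (hy1 : Summable fun k => y k * k) :
    DifferentiableOn ℂ (reducedDen C s y) (Metric.ball 0 1) :=
  ((differentiable_iterGeom 1 C).differentiableOn.sub
    ((differentiableOn_tailPGF hy (by simpa using hy1)).mul
      differentiable_spaceTail.differentiableOn)).sub
    differentiable_spaceTail.differentiableOn

theorem norm_truncDen_sub_reducedDen_le (hs : ∀ u, 0 ≤ s u)
    (hs1 : ∑ u ∈ Finset.range (C + 1), s u = 1) (hy : ∀ k, 0 ≤ y k)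
    (hy1 : Summable fun k => y k * k) (N : ℕ) {z : ℂ} (hz : ‖z‖ ≤ 1) :
    ‖truncDen C s y N z - reducedDen C s y z‖ ≤
      factMoment y 1 - ∑ k ∈ Finset.range N, y k * k := by
  have hy1' : Summable fun k => y k * k.choose 1 := by simpa using hy1
  have h1 : truncDen C s y N z - reducedDen C s y z =
      (tailPGF y 1 z - ∑ k ∈ Finset.range N, (y k : ℂ) * iterGeom 1 k z) * spaceTail C s 0 z := by
    simp only [truncDen, reducedDen, Complex.coe_algebraMap]
    ring
  have h2 : tailPGF y 1 z - ∑ k ∈ Finset.range N, (y k : ℂ) * iterGeom 1 k z =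
      ∑' k, (y (k + N) : ℂ) * iterGeom 1 (k + N) z := by
    rw [sub_eq_iff_eq_add', tailPGF]
    exact ((summable_tailPGF hy hy1' hz).sum_add_tsum_nat_add N).symm
  have h3 : factMoment y 1 - ∑ k ∈ Finset.range N, y k * k =
      ∑' k, y (k + N) * (k + N).choose 1 := by
    rw [sub_eq_iff_eq_add', factMoment, ← hy1'.sum_add_tsum_nat_add N]
    simp
  rw [h1, norm_mul, h2, h3]
  refine (mul_le_of_le_one_right (norm_nonneg _) (norm_spaceTail_zero_le_one hs hs1 hz)).trans ?_
  exact tsum_of_norm_bounded ((summable_nat_add_iff N).2 hy1').hasSum fun k =>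
    norm_term_tailPGF_le (a := y) hy 1 (k + N) hz

theorem sq_norm_eq_re_sq_add_im_sq (z : ℂ) : ‖z‖ ^ 2 = z.re ^ 2 + z.im ^ 2 := by
  rw [Complex.sq_norm, Complex.normSq_apply]
  ring

/-- Strictness comes from the terms `y 0 + y 1 * z`: they point in the same direction only if
`z = 1`. -/
theorem norm_tailPGF_zero_lt_one (hy : ∀ k, 0 ≤ y k) (hy0 : HasSum y 1) (h0 : 0 < y 0)
    (h1 : 0 < y 1) {z : ℂ} (hz : ‖z‖ = 1) (hz1 : z ≠ 1) : ‖tailPGF y 0 z‖ < 1 := by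
  have hys : Summable fun k => y k * k.choose 0 := by simpa using hy0.summable
  have h2 : tailPGF y 0 z = (y 0 + y 1 * z) + ∑' k, (y (k + 2) : ℂ) * iterGeom 0 (k + 2) z := by
    rw [tailPGF, ← (summable_tailPGF hy hys hz.le).sum_add_tsum_nat_add 2]
    simp [Finset.sum_range_succ, iterGeom_zero]
  have h3 : 1 = (y 0 + y 1) + ∑' k, y (k + 2) := by
    rw [← hy0.tsum_eq, ← hy0.summable.sum_add_tsum_nat_add 2]
    simp [Finset.sum_range_succ]
  have h4 : ‖∑' k, (y (k + 2) : ℂ) * iterGeom 0 (k + 2) z‖ ≤ ∑' k, y (k + 2) :=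
    tsum_of_norm_bounded ((summable_nat_add_iff 2).2 hy0.summable).hasSum fun k => by
      simpa using norm_term_tailPGF_le (a := y) hy 0 (k + 2) hz.le
  have hre : z.re < 1 := by
    refine lt_of_le_of_ne ((Complex.re_le_norm z).trans hz.le) fun h => hz1 ?_
    have h5 : z.re ^ 2 + z.im ^ 2 = 1 := by
      rw [← sq_norm_eq_re_sq_add_im_sq, hz, one_pow]
    rw [h] at h5
    apply Complex.ext
    · simpa using h
    · have : z.im ^ 2 = 0 := by linarith
      simpa using this
  have h5 : ‖(y 0 + y 1 * z : ℂ)‖ < y 0 + y 1 := by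
    refine lt_of_pow_lt_pow_left₀ 2 (by linarith) ?_
    have h6 : z.re ^ 2 + z.im ^ 2 = 1 := by
      rw [← sq_norm_eq_re_sq_add_im_sq, hz, one_pow]
    rw [sq_norm_eq_re_sq_add_im_sq]
    simp
    have h7 : (y 0 + y 1) ^ 2 - ((y 0 + y 1 * z.re) ^ 2 + (y 1 * z.im) ^ 2) =
        2 * (y 0 * y 1 * (1 - z.re)) := by
      linear_combination -(y 1) ^ 2 * h6
    have h8 := mul_pos (mul_pos h0 h1) (sub_pos.2 hre)
    linarith
  rw [h2]
  refine (norm_add_le _ _).trans_lt ?_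
  linarith

theorem reducedDen_ne_zero_of_norm_eq_one (hs : ∀ u, 0 ≤ s u)
    (hs1 : ∑ u ∈ Finset.range (C + 1), s u = 1) (hy : ∀ k, 0 ≤ y k) (hy0 : HasSum y 1)
    (hy1 : Summable fun k => y k * k) (h0 : 0 < y 0) (h1 : 0 < y 1)
    (hpos : 0 < C - factMoment y 1 - spaceMoment C s 1) {z : ℂ} (hz : ‖z‖ = 1) :
    reducedDen C s y z ≠ 0 := by
  by_cases hz1 : z = 1
  · rw [hz1, reducedDen_apply_one hs1]
    exact_mod_cast hpos.ne'
  intro h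
  have h2 := sub_one_mul_reducedDen hs1 hy hy0 hy1 hz.le
  rw [h, mul_zero, eq_comm, sub_eq_zero] at h2
  have h3 := congrArg norm h2
  rw [norm_pow, hz, one_pow, norm_mul] at h3
  have h4 := norm_tailPGF_zero_lt_one hy hy0 h0 h1 hz hz1
  have h5 := norm_spaceTail_zero_le_one hs hs1 hz.le
  have h6 := mul_lt_mul_of_lt_of_le_of_nonneg_of_pos h4 h5 (norm_nonneg _) one_pos
  linarith

/-- The reduced denominator has exactly `C - 1` zeros in the open disk, with multiplicity. The
finite set `t` is only used to know in advance that there are finitely many. -/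
theorem exists_reducedDen_eq_polynomial_mul (hs : ∀ u, 0 ≤ s u)
    (hs1 : ∑ u ∈ Finset.range (C + 1), s u = 1) (hy : ∀ k, 0 ≤ y k) (hy0 : HasSum y 1)
    (hy1 : Summable fun k => y k * k) (h0 : 0 < y 0) (h1 : 0 < y 1)
    (hpos : 0 < C - factMoment y 1 - spaceMoment C s 1) (t : Finset ℂ)
    (hzeros : ∀ z : ℂ, ‖z‖ < 1 → reducedDen C s y z = 0 → z ∈ t) :
    ∃ (p : Polynomial ℂ) (g : ℂ → ℂ), p ≠ 0 ∧ DifferentiableOn ℂ g (Metric.ball 0 1) ∧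
      (∀ z : ℂ, ‖z‖ < 1 → g z ≠ 0) ∧
      (∀ z : ℂ, ‖z‖ < 1 → reducedDen C s y z = p.eval z * g z) ∧ (∀ w ∈ p.roots, ‖w‖ < 1) ∧
      p.roots.card = C - 1 := by
  classical
  obtain ⟨p, g, hp, hg, hg0, hpg, hroots⟩ := exists_eq_polynomial_mul_of_finite_zeros
    Metric.isOpen_ball t (differentiableOn_reducedDen (C := C) (s := s) hy hy1)
    fun z hz h => hzeros z (by simpa using hz) h
  refine ⟨p, g, hp, hg, fun z hz => hg0 z (by simpa using hz),
    fun z hz => hpg z (by simpa using hz), fun w hw => by simpa using hroots w hw, ?_⟩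
  have hzero : ∀ z : ℂ, ‖z‖ < 1 → reducedDen C s y z = 0 → z ∈ p.roots := fun z hz h => by
    rw [hpg z (by simpa using hz)] at h
    exact (Polynomial.mem_roots hp).2
      ((mul_eq_zero.1 h).resolve_right (hg0 z (by simpa using hz)))
  -- The zeros are finitely many, hence stay away from the unit circle.
  obtain ⟨ρ, hρ, hρ0 : 0 < ρ, hρ1 : ρ < 1⟩ : ∃ ρ : ℝ, (∀ w ∈ p.roots.toFinset, ‖w‖ < ρ) ∧
      0 < ρ ∧ ρ < 1 := by
    have h2 : ∀ᶠ ρ : ℝ in 𝓝[<] 1, ∀ w ∈ p.roots.toFinset, ‖w‖ < ρ := by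
      rw [Finset.eventually_all]
      intro w hw
      have hw1 : ‖w‖ < 1 := by simpa using hroots w (Multiset.mem_toFinset.1 hw)
      filter_upwards [Ioo_mem_nhdsLT hw1] with ρ hρ using hρ.1
    obtain ⟨ρ, h3, h4⟩ := (h2.and (Ioo_mem_nhdsLT (show (0 : ℝ) < 1 by norm_num))).exists
    exact ⟨ρ, h3, h4.1, h4.2⟩
  have hρ' : ∀ w ∈ p.roots, ‖w‖ < ρ := fun w hw => hρ w (Multiset.mem_toFinset.2 hw)
  have hne : ∀ z : ℂ, ρ ≤ ‖z‖ → ‖z‖ ≤ 1 → reducedDen C s y z ≠ 0 := by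
    intro z hz1 hz2 h
    rcases hz2.lt_or_eq with hz | hz
    · exact absurd (hρ' z (hzero z hz h)) (not_lt.2 hz1)
    · exact reducedDen_ne_zero_of_norm_eq_one hs hs1 hy hy0 hy1 h0 h1 hpos hz h
  obtain ⟨δ, hδ, hδle⟩ : ∃ δ > 0, ∀ z : ℂ, ρ ≤ ‖z‖ → ‖z‖ ≤ 1 → δ ≤ ‖reducedDen C s y z‖ := by
    have hcomp : IsCompact (Metric.closedBall (0 : ℂ) 1 ∩ {z | ρ ≤ ‖z‖}) :=
      (isCompact_closedBall 0 1).inter_right (isClosed_le continuous_const continuous_norm)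
    obtain ⟨z₀, hz₀, hmin⟩ := hcomp.exists_isMinOn ⟨1, by simp, by simpa using hρ1.le⟩
      ((continuousOn_reducedDen (C := C) (s := s) hy hy1).norm.mono Set.inter_subset_left)
    refine ⟨‖reducedDen C s y z₀‖, norm_pos_iff.2 (hne z₀ hz₀.2 (by simpa using hz₀.1)),
      fun z hz1 hz2 => hmin ⟨by simpa using hz2, hz1⟩⟩
  have hlim : Tendsto (fun N => factMoment y 1 - ∑ k ∈ Finset.range N, y k * k) atTop (𝓝 0) := by
    have h2 : factMoment y 1 = ∑' k, y k * k := by simp [factMoment]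
    rw [h2, ← sub_self (∑' k, y k * k)]
    exact hy1.hasSum.tendsto_sum_nat.const_sub _
  obtain ⟨N, hN⟩ := (hlim.eventually (gt_mem_nhds hδ)).exists
  have hle : ∀ z : ℂ, ρ ≤ ‖z‖ → ‖z‖ ≤ 1 →
      ‖truncDen C s y N z - reducedDen C s y z‖ < ‖reducedDen C s y z‖ := fun z hz1 hz2 =>
    ((norm_truncDen_sub_reducedDen_le hs hs1 hy hy1 N hz2).trans_lt hN).trans_le (hδle z hz1 hz2)
  have hsumle : ∑ k ∈ Finset.range N, y k * k ≤ factMoment y 1 := by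
    have h2 : factMoment y 1 = ∑' k, y k * k := by simp [factMoment]
    rw [h2]
    exact hy1.sum_le_tsum _ fun k _ => mul_nonneg (hy k) (Nat.cast_nonneg k)
  have hcard := card_roots_truncDen (C := C) (N := N) hs hs1 hy
    (by rw [← hy0.tsum_eq]; exact hy0.summable.sum_le_tsum _ fun k _ => hy k) (by linarith)
  set E := truncDen C s y N (Polynomial.X : Polynomial ℂ) with hE
  have hEe : ∀ z, E.eval z = truncDen C s y N z := eval_truncDen_X
  have hE1 : ∀ z : ℂ, ρ ≤ ‖z‖ → ‖z‖ ≤ 1 → E.eval z ≠ 0 := fun z hz1 hz2 h => by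
    have h2 := hle z hz1 hz2
    rw [← hEe, h, zero_sub, norm_neg] at h2
    exact lt_irrefl _ h2
  have hE0 : E ≠ 0 := fun h => hE1 1 (by simpa using hρ1.le) (by simp) (by simp [h])
  have hsub : Metric.closedBall (0 : ℂ) ρ ⊆ Metric.ball 0 1 := Metric.closedBall_subset_ball hρ1
  have hrouche := circleIntegral_logDeriv_eq_of_norm_sub_lt (f := fun z => E.eval z)
    (g := reducedDen C s y) Metric.isOpen_ball hρ0.le
    (Metric.sphere_subset_closedBall.trans hsub)
    E.differentiable.differentiableOn (differentiableOn_reducedDen hy hy1) fun z hz => by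
      have hz' : ‖z‖ = ρ := by simpa using hz
      simpa only [hEe] using hle z hz'.ge (hz'.le.trans hρ1.le)
  rw [circleIntegral_logDeriv_eq_card_roots (g := fun _ => 1) isOpen_univ hρ0 (Set.subset_univ _)
      (differentiableOn_const _) (by simp) hE0 (by simp)
      (fun w hw h => hE1 w h.ge (h.le.trans hρ1.le) ((Polynomial.mem_roots hE0).1 hw)),
    circleIntegral_logDeriv_eq_card_roots Metric.isOpen_ball hρ0 hsub hg hg0 hp hpg
      (fun w hw => (hρ' w hw).ne)] at hrouche
  have h2 := mul_left_cancel₀ Complex.two_pi_I_ne_zero hrouche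
  rw [Multiset.filter_eq_self.2 hρ'] at h2
  rw [← hcard, ← Nat.cast_inj (R := ℂ), ← h2]
  congr 2
  refine Multiset.filter_congr fun w hw => ⟨fun h => h.le.trans hρ1.le, fun h => ?_⟩
  by_contra hlt
  exact hE1 w (not_lt.1 hlt) h ((Polynomial.mem_roots hE0).1 hw)

end reducedDen

/-! ### Root lists of the denominator -/

theorem lawPGF_eq_tailPGF (ν : Measure ℕ) : lawPGF ν = tailPGF (fun k => ν.real {k}) 0 := rfl

theorem hasSum_measureReal_singleton (ν : Measure ℕ) [IsProbabilityMeasure ν] :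
    HasSum (fun k => ν.real {k}) 1 := by
  have h1 : ∑' k, ν {k} = 1 := by
    rw [← measure_univ (μ := ν), ← Measure.tsum_indicator_apply_singleton ν _ MeasurableSet.univ]
    simp
  have h2 : Summable fun k => ν.real {k} := ENNReal.summable_toReal (by rw [h1]; simp)
  rw [h2.hasSum_iff]
  simp only [measureReal_def]
  rw [← ENNReal.tsum_toReal_eq (fun k => measure_ne_top _ _), h1, ENNReal.toReal_one]

theorem sum_measureReal_singleton_eq_one {ν : Measure ℕ} [IsProbabilityMeasure ν] {C : ℕ}
    (hν : ∀ᵐ b ∂ν, b ≤ C) : ∑ u ∈ Finset.range (C + 1), ν.real {u} = 1 := by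
  have h := (integral_eq_sum_of_ae_le hν (fun _ => (1 : ℝ))).2
  simpa using h.symm

theorem exists_fin_map_eq {α : Type*} {n : ℕ} (t : Multiset α) (ht : t.card = n) :
    ∃ w : Fin n → α, Finset.univ.val.map w = t := by
  subst ht
  refine ⟨fun i => t.toList.get (i.cast t.length_toList.symm), ?_⟩
  rw [Fin.univ_val_map]
  conv_rhs => rw [← t.coe_toList]
  refine congrArg _ (List.ext_get (by simp) fun n h1 h2 => by simp)

theorem natCard_fiber_eq_count {α : Type*} [DecidableEq α] {n : ℕ} (w : Fin n → α) (a : α) :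
    Nat.card {i // w i = a} = (Finset.univ.val.map w).count a := by
  rw [Nat.card_eq_fintype_card, Fintype.card_subtype, Multiset.count_map]
  simp [eq_comm, Finset.card_def]

/-- Two root lists of the same function differ by a permutation. -/
theorem IsNonunitRootList.map_eq {f : ℂ → ℂ} {n : ℕ} {z w : Fin n → ℂ}
    (hz : IsNonunitRootList f z) (hw : IsNonunitRootList f w) :
    (Finset.univ.val.map z : Multiset ℂ) = Finset.univ.val.map w := by
  classical
  ext a
  by_cases ha : ‖a‖ ≤ 1 ∧ a ≠ 1
  · have h := (hz.2 a ha.1 ha.2).trans (hw.2 a ha.1 ha.2).symm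
    rw [Nat.cast_inj, natCard_fiber_eq_count, natCard_fiber_eq_count] at h
    exact h
  · rw [Multiset.count_eq_zero_of_notMem, Multiset.count_eq_zero_of_notMem]
    · simp only [Multiset.mem_map, not_exists, not_and]
      rintro i - rfl
      exact ha (hw.1 i)
    · simp only [Multiset.mem_map, not_exists, not_and]
      rintro i - rfl
      exact ha (hz.1 i)

theorem prod_X_sub_C_eq_of_map_eq {n : ℕ} {w : Fin n → ℂ} {t : Multiset ℂ}
    (h : Finset.univ.val.map w = t) :
    ∏ i, (Polynomial.X - Polynomial.C (w i)) =
      (t.map fun a => Polynomial.X - Polynomial.C a).prod := by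
  rw [← h, Multiset.map_map]
  rfl

section RootList

variable {C : ℕ} {νQ νS νY : Measure ℕ}

theorem queueDen_add (z : ℂ) (hz : lawPGF νY z ≠ 0) :
    (queueDen C νS νY z + spaceTail C (fun u => νS.real {u}) 0 z) * lawPGF νY z = z ^ C := by
  have h : spaceTail C (fun u => νS.real {u}) 0 z =
      ∑ u ∈ Finset.range (C + 1), (νS.real {u} : ℂ) * z ^ (C - u) := rfl
  rw [h, queueDen, sub_add_cancel, div_mul_cancel₀ _ hz]

theorem continuousOn_lawPGF [IsProbabilityMeasure νY] :
    ContinuousOn (lawPGF νY) (Metric.closedBall 0 1) :=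
  continuousOn_tailPGF (a := fun k => νY.real {k}) (m := 0) (fun _ => measureReal_nonneg)
    (by simpa using (hasSum_measureReal_singleton νY).summable)

theorem differentiableOn_lawPGF [IsProbabilityMeasure νY] :
    DifferentiableOn ℂ (lawPGF νY) (Metric.ball 0 1) :=
  differentiableOn_tailPGF (a := fun k => νY.real {k}) (m := 0) (fun _ => measureReal_nonneg)
    (by simpa using (hasSum_measureReal_singleton νY).summable)

theorem lawPGF_apply_zero (ν : Measure ℕ) : lawPGF ν 0 = ν.real {0} :=
  tailPGF_zero_apply_zero _

/-- Where `Y(z)` vanishes, including on the unit circle, `z ^ C / Y(z)` is unbounded nearby, so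
that the denominator is not analytic there. The point `0` is excluded by `Y(0) > 0`. -/
theorem analyticOrderAt_queueDen_eq_zero_of_lawPGF_eq_zero [IsProbabilityMeasure νY]
    (h0 : 0 < νY.real {0}) {w : ℂ} (hw : ‖w‖ ≤ 1) (hYw : lawPGF νY w = 0) :
    analyticOrderAt (queueDen C νS νY) w = 0 := by
  by_contra hne
  obtain ⟨hana, hzero⟩ := analyticOrderAt_ne_zero.1 hne
  have hY0 : lawPGF νY 0 ≠ 0 := by
    rw [lawPGF_apply_zero]
    exact_mod_cast h0.ne'
  set F : Filter ℂ := 𝓝[Metric.ball 0 1 ∩ {z | lawPGF νY z ≠ 0}] w with hF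
  -- By the identity theorem `Y` is nonzero at points of the open disk arbitrarily close to `w`.
  have hbot : F.NeBot := by
    rw [hF, ← mem_closure_iff_nhdsWithin_neBot, mem_closure_iff]
    intro o ho hwo
    have hcl : w ∈ closure (Metric.ball (0 : ℂ) 1) := by
      rw [closure_ball _ one_ne_zero]
      simpa using hw
    obtain ⟨z₁, hz₁o, hz₁⟩ := mem_closure_iff.1 hcl o ho hwo
    by_contra hemp
    have hev : lawPGF νY =ᶠ[𝓝 z₁] 0 := by
      filter_upwards [(ho.inter Metric.isOpen_ball).mem_nhds ⟨hz₁o, hz₁⟩] with z hz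
      by_contra hz0
      exact hemp ⟨z, hz.1, hz.2, hz0⟩
    have := (differentiableOn_lawPGF (νY := νY)).analyticOnNhd
      Metric.isOpen_ball |>.eqOn_zero_of_preconnected_of_eventuallyEq_zero
      (convex_ball (0 : ℂ) 1).isPreconnected hz₁ hev
    exact hY0 (this (by simp))
  have h1 : Tendsto (fun z => (queueDen C νS νY z + spaceTail C (fun u => νS.real {u}) 0 z) *
      lawPGF νY z) F (𝓝 ((queueDen C νS νY w + spaceTail C (fun u => νS.real {u}) 0 w) *
      lawPGF νY w)) := by
    refine Tendsto.mul (Tendsto.add ?_ ?_) ?_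
    · exact hana.continuousAt.tendsto.mono_left nhdsWithin_le_nhds
    · exact (differentiable_spaceTail.continuous.tendsto w).mono_left nhdsWithin_le_nhds
    · exact (continuousOn_lawPGF w (by simpa using hw)).mono_left (nhdsWithin_mono _
        (Set.inter_subset_left.trans Metric.ball_subset_closedBall))
  have h2 : Tendsto (fun z : ℂ => z ^ C) F (𝓝 (w ^ C)) :=
    ((continuous_pow C).tendsto w).mono_left nhdsWithin_le_nhds
  have h3 : w ^ C = 0 := by
    rw [hYw, mul_zero] at h1
    refine tendsto_nhds_unique h2 (h1.congr' ?_)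
    filter_upwards [self_mem_nhdsWithin] with z hz using queueDen_add z hz.2
  rw [eq_zero_of_pow_eq_zero h3] at hYw
  exact hY0 hYw

variable [IsProbabilityMeasure νQ] [IsProbabilityMeasure νS] [IsProbabilityMeasure νY]

theorem queueDen_eq_div (hS : ∀ᵐ b ∂νS, b ≤ C) (hy1 : Summable fun k => νY.real {k} * k) {z : ℂ}
    (hz : ‖z‖ ≤ 1) (hYz : lawPGF νY z ≠ 0) :
    queueDen C νS νY z =
      (z - 1) * reducedDen C (fun u => νS.real {u}) (fun k => νY.real {k}) z / lawPGF νY z := by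
  rw [eq_div_iff hYz]
  have h1 := sub_one_mul_reducedDen (C := C) (s := fun u => νS.real {u})
    (y := fun k => νY.real {k}) (sum_measureReal_singleton_eq_one hS)
    (fun _ => measureReal_nonneg) (hasSum_measureReal_singleton νY) hy1 hz
  have h2 := queueDen_add (C := C) (νS := νS) z hYz
  rw [h1, ← lawPGF_eq_tailPGF]
  linear_combination h2

theorem reducedDen_ne_zero_of_lawPGF_eq_zero (hS : ∀ᵐ b ∂νS, b ≤ C)
    (hy1 : Summable fun k => νY.real {k} * k) (h0 : 0 < νY.real {0}) {z : ℂ} (hz : ‖z‖ ≤ 1)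
    (hYz : lawPGF νY z = 0) :
    reducedDen C (fun u => νS.real {u}) (fun k => νY.real {k}) z ≠ 0 := by
  intro h
  have h1 := sub_one_mul_reducedDen (C := C) (s := fun u => νS.real {u})
    (y := fun k => νY.real {k}) (sum_measureReal_singleton_eq_one hS)
    (fun _ => measureReal_nonneg) (hasSum_measureReal_singleton νY) hy1 hz
  rw [← lawPGF_eq_tailPGF, hYz, h, mul_zero, zero_mul, sub_zero] at h1
  have h2 : z = 0 := eq_zero_of_pow_eq_zero h1.symm
  rw [h2, lawPGF_apply_zero] at hYz
  exact h0.ne' (by exact_mod_cast hYz)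

theorem analyticOrderAt_queueDen (hS : ∀ᵐ b ∂νS, b ≤ C)
    (hy1 : Summable fun k => νY.real {k} * k) (h0 : 0 < νY.real {0}) {w : ℂ} (hw : ‖w‖ < 1) :
    analyticOrderAt (queueDen C νS νY) w =
      analyticOrderAt (reducedDen C (fun u => νS.real {u}) (fun k => νY.real {k})) w := by
  have hball : Metric.ball (0 : ℂ) 1 ∈ 𝓝 w := Metric.isOpen_ball.mem_nhds (by simpa using hw)
  have hE : AnalyticAt ℂ (reducedDen C (fun u => νS.real {u}) (fun k => νY.real {k})) w :=
    (differentiableOn_reducedDen (fun _ => measureReal_nonneg) hy1).analyticAt hball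
  by_cases hYw : lawPGF νY w = 0
  · rw [analyticOrderAt_queueDen_eq_zero_of_lawPGF_eq_zero h0 hw.le hYw,
      hE.analyticOrderAt_eq_zero.2 (reducedDen_ne_zero_of_lawPGF_eq_zero hS hy1 h0 hw.le hYw)]
  · have hYa : AnalyticAt ℂ (lawPGF νY) w := differentiableOn_lawPGF.analyticAt hball
    have hfac : AnalyticAt ℂ (fun z => (z - 1) / lawPGF νY z) w :=
      (analyticAt_id.sub analyticAt_const).div hYa hYw
    have hev : queueDen C νS νY =ᶠ[𝓝 w] (fun z => (z - 1) / lawPGF νY z) *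
        reducedDen C (fun u => νS.real {u}) (fun k => νY.real {k}) := by
      filter_upwards [hball, hYa.continuousAt.eventually_ne hYw] with z hz hYz
      rw [queueDen_eq_div hS hy1 (by simpa using (Metric.ball_subset_closedBall hz)) hYz,
        Pi.mul_apply]
      ring
    have hw1 : w ≠ 1 := fun h => by simp [h] at hw
    rw [analyticOrderAt_congr hev, analyticOrderAt_mul hfac hE,
      hfac.analyticOrderAt_eq_zero.2 (div_ne_zero (sub_ne_zero.2 hw1) hYw), zero_add]

theorem analyticOrderAt_queueDen_eq_zero (hS : ∀ᵐ b ∂νS, b ≤ C)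
    (hy1 : Summable fun k => νY.real {k} * k) (h0 : 0 < νY.real {0}) {w : ℂ} (hw : ‖w‖ ≤ 1)
    (hw1 : w ≠ 1)
    (hE : reducedDen C (fun u => νS.real {u}) (fun k => νY.real {k}) w ≠ 0) :
    analyticOrderAt (queueDen C νS νY) w = 0 := by
  by_cases hYw : lawPGF νY w = 0
  · exact analyticOrderAt_queueDen_eq_zero_of_lawPGF_eq_zero h0 hw hYw
  · rw [analyticOrderAt_eq_zero, queueDen_eq_div hS hy1 hw hYw]
    exact Or.inr (div_ne_zero (mul_ne_zero (sub_ne_zero.2 hw1) hE) hYw)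

/-- The root list when `Y` charges `1`. The zeros of `E` are zeros of `M` since `Q E = Y M` and
`Y` does not vanish there, and they exhaust the degree of `M`. -/
theorem exists_rootList_of_pos (hS : ∀ᵐ b ∂νS, b ≤ C)
    (hy1 : Summable fun k => νY.real {k} * k) (h0 : 0 < νY.real {0}) (h1 : 0 < νY.real {1})
    (hpos : 0 < C - factMoment (fun k => νY.real {k}) 1 - spaceMoment C (fun u => νS.real {u}) 1)
    {M : Polynomial ℂ} (hdeg : M.natDegree ≤ C - 1) (hM : M ≠ 0)
    (hfun : ∀ z : ℂ, ‖z‖ < 1 → lawPGF νQ z *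
      reducedDen C (fun u => νS.real {u}) (fun k => νY.real {k}) z = lawPGF νY z * M.eval z) :
    ∃ (w : Fin (C - 1) → ℂ) (c : ℂ), IsNonunitRootList (queueDen C νS νY) w ∧
      M = Polynomial.C c * ∏ i, (Polynomial.X - Polynomial.C (w i)) := by
  classical
  have hs1 := sum_measureReal_singleton_eq_one hS
  have hsn : ∀ u, 0 ≤ νS.real {u} := fun _ => measureReal_nonneg
  have hyn : ∀ u, 0 ≤ νY.real {u} := fun _ => measureReal_nonneg
  have hysum := hasSum_measureReal_singleton νY
  have hYne : ∀ z : ℂ, ‖z‖ < 1 →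
      reducedDen C (fun u => νS.real {u}) (fun k => νY.real {k}) z = 0 → lawPGF νY z ≠ 0 :=
    fun z hz h hY => reducedDen_ne_zero_of_lawPGF_eq_zero hS hy1 h0 hz.le hY h
  obtain ⟨p, g, hp, hg, hg0, hpg, hroots, hcard⟩ := exists_reducedDen_eq_polynomial_mul hsn hs1 hyn
    hysum hy1 h0 h1 hpos M.roots.toFinset fun z hz h => by
      have h2 := hfun z hz
      rw [h, mul_zero, eq_comm] at h2
      exact Multiset.mem_toFinset.2 ((Polynomial.mem_roots hM).2
        ((mul_eq_zero.1 h2).resolve_left (hYne z hz h)))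
  have hball : ∀ {v : ℂ}, ‖v‖ < 1 → Metric.ball (0 : ℂ) 1 ∈ 𝓝 v := fun hv =>
    Metric.isOpen_ball.mem_nhds (by simpa using hv)
  have hord : ∀ v : ℂ, ‖v‖ < 1 → analyticOrderAt
      (reducedDen C (fun u => νS.real {u}) (fun k => νY.real {k})) v = p.roots.count v := by
    intro v hv
    have hga : AnalyticAt ℂ g v := hg.analyticAt (hball hv)
    have hpa : AnalyticAt ℂ (fun z => p.eval z) v :=
      AnalyticOnNhd.eval_polynomial (A := ℂ) p v (Set.mem_univ _)
    have hev : reducedDen C (fun u => νS.real {u}) (fun k => νY.real {k}) =ᶠ[𝓝 v]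
        (fun z => p.eval z) * g := by
      filter_upwards [hball hv] with z hz using hpg z (by simpa using hz)
    rw [analyticOrderAt_congr hev, analyticOrderAt_mul hpa hga,
      hga.analyticOrderAt_eq_zero.2 (hg0 v hv), add_zero, Polynomial.analyticOrderAt_eval hp,
      Polynomial.count_roots]
  obtain ⟨w, hw⟩ := exists_fin_map_eq p.roots hcard
  have hwmem : ∀ i, w i ∈ p.roots := fun i => by
    rw [← hw]
    exact Multiset.mem_map_of_mem w (Finset.mem_univ_val i)
  have hlist : IsNonunitRootList (queueDen C νS νY) w := by
    refine ⟨fun i => ⟨(hroots _ (hwmem i)).le, fun h => ?_⟩, fun v hv hv1 => ?_⟩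
    · have := hroots _ (hwmem i)
      simp [h] at this
    · rw [natCard_fiber_eq_count, hw]
      rcases hv.lt_or_eq with hlt | heq
      · rw [analyticOrderAt_queueDen hS hy1 h0 hlt, hord v hlt]
      · rw [analyticOrderAt_queueDen_eq_zero hS hy1 h0 hv hv1
          (reducedDen_ne_zero_of_norm_eq_one hsn hs1 hyn hysum hy1 h0 h1 hpos heq),
          Multiset.count_eq_zero_of_notMem]
        · simp
        · intro h
          exact absurd heq (hroots v h).ne
  have hle : p.roots ≤ M.roots := by
    rw [Multiset.le_iff_count]
    intro v
    by_cases hv : v ∈ p.roots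
    swap
    · rw [Multiset.count_eq_zero_of_notMem hv]
      exact Nat.zero_le _
    have hv1 := hroots v hv
    have hE0 : reducedDen C (fun u => νS.real {u}) (fun k => νY.real {k}) v = 0 := by
      rw [hpg v hv1, (Polynomial.mem_roots hp).1 hv, zero_mul]
    have hYa : AnalyticAt ℂ (lawPGF νY) v := differentiableOn_lawPGF.analyticAt (hball hv1)
    have hQa : AnalyticAt ℂ (lawPGF νQ) v := differentiableOn_lawPGF.analyticAt (hball hv1)
    have hEa : AnalyticAt ℂ (reducedDen C (fun u => νS.real {u}) (fun k => νY.real {k})) v :=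
      (differentiableOn_reducedDen hyn hy1).analyticAt (hball hv1)
    have hMa : AnalyticAt ℂ (fun z => M.eval z) v :=
      AnalyticOnNhd.eval_polynomial (A := ℂ) M v (Set.mem_univ _)
    have hev : lawPGF νQ * reducedDen C (fun u => νS.real {u}) (fun k => νY.real {k}) =ᶠ[𝓝 v]
        lawPGF νY * fun z => M.eval z := by
      filter_upwards [hball hv1] with z hz using hfun z (by simpa using hz)
    have h2 := analyticOrderAt_congr hev
    rw [analyticOrderAt_mul hQa hEa, analyticOrderAt_mul hYa hMa,
      hYa.analyticOrderAt_eq_zero.2 (hYne v hv1 hE0), zero_add, hord v hv1,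
      Polynomial.analyticOrderAt_eval hM, ← Polynomial.count_roots] at h2
    have h3 : ((p.roots.count v : ℕ) : ℕ∞) ≤ (M.roots.count v : ℕ) := by
      rw [← h2]
      exact le_add_self
    exact_mod_cast h3
  have hdvd := (Multiset.prod_X_sub_C_dvd_iff_le_roots hM p.roots).2 hle
  refine ⟨w, M.leadingCoeff, hlist, ?_⟩
  rw [prod_X_sub_C_eq_of_map_eq hw]
  refine Polynomial.eq_leadingCoeff_mul_of_monic_of_dvd_of_natDegree_le ?_ hdvd ?_
  · exact Polynomial.monic_multiset_prod_of_monic _ _ fun a _ => Polynomial.monic_X_sub_C a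
  · rw [Polynomial.natDegree_multiset_prod_X_sub_C_eq_card, hcard]
    exact hdeg

/-- The root list when there are no arrivals. Then `E = M` is a polynomial of degree at most
`C - 1` with `C - 1` roots in the closed disk, some possibly on the unit circle. -/
theorem exists_rootList_of_eq_zero (hS : ∀ᵐ b ∂νS, b ≤ C)
    (hy : ∀ k, k ≠ 0 → νY.real {k} = 0)
    (hpos : 0 < C - factMoment (fun k => νY.real {k}) 1 - spaceMoment C (fun u => νS.real {u}) 1)
    {M : Polynomial ℂ} (hdeg : M.natDegree ≤ C - 1) (hM : M ≠ 0)
    (hfun : ∀ z : ℂ, ‖z‖ < 1 →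
      reducedDen C (fun u => νS.real {u}) (fun k => νY.real {k}) z = M.eval z) :
    ∃ (w : Fin (C - 1) → ℂ) (c : ℂ), IsNonunitRootList (queueDen C νS νY) w ∧
      M = Polynomial.C c * ∏ i, (Polynomial.X - Polynomial.C (w i)) := by
  classical
  have hs1 := sum_measureReal_singleton_eq_one hS
  have hsn : ∀ u, 0 ≤ νS.real {u} := fun _ => measureReal_nonneg
  have hyn : ∀ u, 0 ≤ νY.real {u} := fun _ => measureReal_nonneg
  have hy0 : νY.real {0} = 1 := by
    rw [← (hasSum_measureReal_singleton νY).tsum_eq, tsum_eq_single 0 hy]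
  have hYone : ∀ z, lawPGF νY z = 1 := fun z => by
    rw [lawPGF, tsum_eq_single 0 (fun k hk => by simp [hy k hk])]
    simp [hy0]
  have hE : ∀ z : ℂ, reducedDen C (fun u => νS.real {u}) (fun k => νY.real {k}) z =
      truncDen C (fun u => νS.real {u}) (fun k => νY.real {k}) 0 z := fun z => by
    have h1 : tailPGF (fun k => νY.real {k}) 1 z = 0 := by
      rw [tailPGF, tsum_eq_single 0 (fun k hk => by simp [hy k hk])]
      simp [iterGeom_succ]
    simp [reducedDen, truncDen, h1]
  have hfm : factMoment (fun k => νY.real {k}) 1 = 0 := by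
    rw [factMoment, tsum_eq_single 0 (fun k hk => by simp [hy k hk])]
    simp
  rw [hfm, sub_zero] at hpos
  set E := truncDen C (fun u => νS.real {u}) (fun k => νY.real {k}) 0 (Polynomial.X : Polynomial ℂ)
    with hEdef
  have hcard := card_roots_truncDen (C := C) (N := 0) hsn hs1 hyn (by simp) (by simpa using hpos)
  have hEM : E = M := by
    refine Polynomial.eq_of_infinite_eval_eq E M
      ((infinite_of_mem_nhds (0 : ℂ) (Metric.ball_mem_nhds 0 one_pos)).mono fun z hz => ?_)
    rw [Set.mem_ofPred_eq, hEdef, eval_truncDen_X, ← hE]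
    exact hfun z (by simpa using hz)
  rw [← hEdef, hEM] at hcard
  -- `M` has at most `C - 1` roots, so the `C - 1` roots in the closed disk are all of them.
  have hfilter : M.roots.filter (fun w => ‖w‖ ≤ 1) = M.roots := by
    refine Multiset.eq_of_le_of_card_le (Multiset.filter_le _ _) ?_
    rw [hcard]
    exact (Polynomial.card_roots' M).trans hdeg
  have hM1 : M.eval 1 ≠ 0 := by
    rw [← hEM, hEdef, eval_truncDen_X, truncDen_apply_one hs1]
    simp only [Finset.range_zero, Finset.sum_empty, sub_zero, Complex.coe_algebraMap]
    exact_mod_cast hpos.ne'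
  rw [hfilter] at hcard
  obtain ⟨w, hw⟩ := exists_fin_map_eq M.roots hcard
  have hwmem : ∀ i, w i ∈ M.roots := fun i => by
    rw [← hw]
    exact Multiset.mem_map_of_mem w (Finset.mem_univ_val i)
  have hden : queueDen C νS νY = (fun z => z - 1) * fun z => M.eval z := by
    funext z
    have h1 := sub_one_mul_truncDen (C := C) (s := fun u => νS.real {u})
      (y := fun k => νY.real {k}) (N := 0) hs1 z
    rw [Pi.mul_apply, ← hEM, hEdef, eval_truncDen_X, h1, queueDen, hYone, div_one]
    simp [spaceTail, iterGeom_zero]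
  refine ⟨w, M.leadingCoeff, ⟨fun i => ⟨?_, fun h => ?_⟩, fun v _ hv1 => ?_⟩, ?_⟩
  · have := hwmem i
    rw [← hfilter] at this
    exact (Multiset.mem_filter.1 this).2
  · have := (Polynomial.mem_roots hM).1 (hwmem i)
    rw [h] at this
    exact hM1 this
  · have hMa : AnalyticAt ℂ (fun z => M.eval z) v :=
      AnalyticOnNhd.eval_polynomial (A := ℂ) M v (Set.mem_univ _)
    have h1a : AnalyticAt ℂ (fun z : ℂ => z - 1) v := analyticAt_id.sub analyticAt_const
    rw [natCard_fiber_eq_count, hw, hden, analyticOrderAt_mul h1a hMa,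
      h1a.analyticOrderAt_eq_zero.2 (sub_ne_zero.2 hv1), zero_add,
      Polynomial.analyticOrderAt_eval hM, Polynomial.count_roots]
  · rw [prod_X_sub_C_eq_of_map_eq hw]
    exact (IsAlgClosed.splits M).eq_prod_roots

end RootList

/-! ### Central moments from factorial moments -/

theorem cast_choose_three (k : ℕ) : (k.choose 3 : ℝ) = k * (k - 1) * (k - 2) / 6 := by
  induction k with
  | zero => simp
  | succ k ih =>
    rw [Nat.choose_succ_succ, Nat.cast_add, ih, Nat.cast_choose_two]
    push_cast
    ring

section Moments

theorem integral_sub_integral_sq {ν : Measure ℕ} [IsProbabilityMeasure ν] {f : ℕ → ℕ}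
    (h1 : Integrable (fun k => ((f k).choose 1 : ℝ)) ν)
    (h2 : Integrable (fun k => ((f k).choose 2 : ℝ)) ν) :
    ∫ k, ((f k : ℝ) - ∫ j, (f j : ℝ) ∂ν) ^ 2 ∂ν =
      2 * (∫ k, ((f k).choose 2 : ℝ) ∂ν) + (∫ k, ((f k).choose 1 : ℝ) ∂ν) -
        (∫ k, ((f k).choose 1 : ℝ) ∂ν) ^ 2 := by
  simp only [Nat.choose_one_right] at *
  set m := ∫ j, (f j : ℝ) ∂ν with hm
  have h : ∀ k, ((f k : ℝ) - m) ^ 2 =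
      2 * ((f k).choose 2 : ℝ) + (1 - 2 * m) * (f k : ℝ) + m ^ 2 := fun k => by
    rw [Nat.cast_choose_two]
    ring
  have h12 : Integrable (fun k => 2 * ((f k).choose 2 : ℝ) + (1 - 2 * m) * (f k : ℝ)) ν :=
    (h2.const_mul _).add (h1.const_mul _)
  simp only [h]
  rw [integral_add h12 (integrable_const _),
    integral_add (h2.const_mul _) (h1.const_mul _), integral_const_mul, integral_const_mul, ← hm]
  simp
  ring

theorem integral_sub_integral_cube {ν : Measure ℕ} [IsProbabilityMeasure ν] {f : ℕ → ℕ}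
    (h1 : Integrable (fun k => ((f k).choose 1 : ℝ)) ν)
    (h2 : Integrable (fun k => ((f k).choose 2 : ℝ)) ν)
    (h3 : Integrable (fun k => ((f k).choose 3 : ℝ)) ν) :
    ∫ k, ((f k : ℝ) - ∫ j, (f j : ℝ) ∂ν) ^ 3 ∂ν =
      6 * (∫ k, ((f k).choose 3 : ℝ) ∂ν) + 6 * (∫ k, ((f k).choose 2 : ℝ) ∂ν) +
        (∫ k, ((f k).choose 1 : ℝ) ∂ν) - 3 * (∫ k, ((f k).choose 1 : ℝ) ∂ν) *
        (2 * (∫ k, ((f k).choose 2 : ℝ) ∂ν) + ∫ k, ((f k).choose 1 : ℝ) ∂ν) +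
        2 * (∫ k, ((f k).choose 1 : ℝ) ∂ν) ^ 3 := by
  simp only [Nat.choose_one_right] at *
  set m := ∫ j, (f j : ℝ) ∂ν with hm
  have h : ∀ k, ((f k : ℝ) - m) ^ 3 =
      6 * ((f k).choose 3 : ℝ) + (6 - 6 * m) * ((f k).choose 2 : ℝ) +
        (1 - 3 * m + 3 * m ^ 2) * (f k : ℝ) + (-m ^ 3) := fun k => by
    rw [Nat.cast_choose_two, cast_choose_three]
    ring
  have h23 : Integrable (fun k => 6 * ((f k).choose 3 : ℝ) +
      (6 - 6 * m) * ((f k).choose 2 : ℝ)) ν := (h3.const_mul _).add (h2.const_mul _)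
  have h123 : Integrable (fun k => 6 * ((f k).choose 3 : ℝ) + (6 - 6 * m) * ((f k).choose 2 : ℝ) +
      (1 - 3 * m + 3 * m ^ 2) * (f k : ℝ)) ν := h23.add (h1.const_mul _)
  simp only [h]
  rw [integral_add h123 (integrable_const _), integral_add h23 (h1.const_mul _),
    integral_add (h3.const_mul _) (h2.const_mul _), integral_const_mul, integral_const_mul,
    integral_const_mul, ← hm]
  simp
  ring

theorem integrable_nat_iff_summable {ν : Measure ℕ} [IsFiniteMeasure ν] {f : ℕ → ℝ}
    (hf : ∀ k, 0 ≤ f k) : Integrable f ν ↔ Summable fun k => ν.real {k} * f k := by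
  conv_lhs =>
    rw [← Measure.sum_smul_dirac ν, integrable_sum_dirac_iff (fun k => measure_ne_top _ _)]
  simp [measureReal_def, abs_of_nonneg (hf _)]

theorem integrable_choose {ν : Measure ℕ} [IsFiniteMeasure ν]
    (h3 : Integrable (fun k : ℕ => (k : ℝ) ^ 3) ν) {m : ℕ} (hm0 : m ≠ 0) (hm : m ≤ 3) :
    Integrable (fun k : ℕ => (k.choose m : ℝ)) ν := by
  refine h3.mono (measurable_of_countable _).aestronglyMeasurable (Eventually.of_forall fun k => ?_)
  rw [Real.norm_of_nonneg (Nat.cast_nonneg _), Real.norm_of_nonneg (by positivity)]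
  rcases Nat.eq_zero_or_pos k with rfl | hk
  · rw [Nat.choose_eq_zero_of_lt (Nat.pos_of_ne_zero hm0)]
    simp
  · exact_mod_cast (Nat.choose_le_pow k m).trans (Nat.pow_le_pow_right hk hm)

theorem integral_choose_eq_factMoment {ν : Measure ℕ} {m : ℕ}
    (h : Integrable (fun k : ℕ => (k.choose m : ℝ)) ν) :
    ∫ k, (k.choose m : ℝ) ∂ν = factMoment (fun k => ν.real {k}) m := by
  rw [integral_countable h]
  rfl

theorem lawMean_eq_factMoment {ν : Measure ℕ} (h : Integrable (fun k : ℕ => (k.choose 1 : ℝ)) ν) :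
    lawMean ν = factMoment (fun k => ν.real {k}) 1 := by
  rw [← integral_choose_eq_factMoment h, lawMean]
  simp

theorem lawCentral_eq_integral (ν : Measure ℕ) (p : ℕ) :
    lawCentral ν p = ∫ k : ℕ, ((k : ℝ) - lawMean ν) ^ p ∂ν := rfl

theorem lawMean_eq_sub_spaceMoment {ν : Measure ℕ} [IsProbabilityMeasure ν] {C : ℕ}
    (hν : ∀ᵐ b ∂ν, b ≤ C) : lawMean ν = C - spaceMoment C (fun u => ν.real {u}) 1 := by
  have h1 := integral_eq_sum_of_ae_le hν (fun k => (((C - k : ℕ)).choose 1 : ℝ))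
  have h2 : ∫ k, (((C - k : ℕ)).choose 1 : ℝ) ∂ν = C - lawMean ν := by
    have h3 := integral_eq_sum_of_ae_le hν (fun k => (k : ℝ))
    have h4 : (C : ℝ) - lawMean ν = ∫ k : ℕ, ((C : ℝ) - k) ∂ν := by
      rw [integral_sub (integrable_const _) h3.1, lawMean]
      simp
    rw [h4]
    refine integral_congr_ae ?_
    filter_upwards [hν] with k hk
    rw [Nat.choose_one_right, Nat.cast_sub hk]
  have h3 : spaceMoment C (fun u => ν.real {u}) 1 = ∫ k, (((C - k : ℕ)).choose 1 : ℝ) ∂ν := by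
    rw [h1.2]
    rfl
  rw [h3, h2]
  ring

end Moments

section Space

variable {ν : Measure ℕ} [IsProbabilityMeasure ν] {C : ℕ}

theorem spaceMoment_eq_integral (hν : ∀ᵐ b ∂ν, b ≤ C) (m : ℕ) :
    spaceMoment C (fun u => ν.real {u}) m = ∫ k, ((C - k : ℕ).choose m : ℝ) ∂ν := by
  rw [(integral_eq_sum_of_ae_le hν _).2]
  rfl

/-- The central moments of the space are, up to sign, those of the occupied space `C - S`. -/
theorem lawCentral_eq_integral_sub (hν : ∀ᵐ b ∂ν, b ≤ C) (p : ℕ) :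
    lawCentral ν p = (-1) ^ p *
      ∫ k, (((C - k : ℕ) : ℝ) - ∫ j, ((C - j : ℕ) : ℝ) ∂ν) ^ p ∂ν := by
  have h1 : ∫ j, ((C - j : ℕ) : ℝ) ∂ν = spaceMoment C (fun u => ν.real {u}) 1 := by
    rw [spaceMoment_eq_integral hν]
    simp
  rw [h1, lawCentral_eq_integral, lawMean_eq_sub_spaceMoment hν, ← integral_const_mul]
  refine integral_congr_ae ?_
  filter_upwards [hν] with k hk
  rw [← mul_pow, Nat.cast_sub hk]
  ring

theorem lawCentral_two_eq_spaceMoment (hν : ∀ᵐ b ∂ν, b ≤ C) :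
    lawCentral ν 2 = 2 * spaceMoment C (fun u => ν.real {u}) 2 +
      spaceMoment C (fun u => ν.real {u}) 1 - spaceMoment C (fun u => ν.real {u}) 1 ^ 2 := by
  rw [lawCentral_eq_integral_sub hν, integral_sub_integral_sq (integral_eq_sum_of_ae_le hν _).1
    (integral_eq_sum_of_ae_le hν _).1]
  simp only [spaceMoment_eq_integral hν]
  ring

theorem lawCentral_three_eq_spaceMoment (hν : ∀ᵐ b ∂ν, b ≤ C) :
    lawCentral ν 3 = -(6 * spaceMoment C (fun u => ν.real {u}) 3 +
      6 * spaceMoment C (fun u => ν.real {u}) 2 + spaceMoment C (fun u => ν.real {u}) 1 -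
      3 * spaceMoment C (fun u => ν.real {u}) 1 * (2 * spaceMoment C (fun u => ν.real {u}) 2 +
        spaceMoment C (fun u => ν.real {u}) 1) +
      2 * spaceMoment C (fun u => ν.real {u}) 1 ^ 3) := by
  rw [lawCentral_eq_integral_sub hν, integral_sub_integral_cube (integral_eq_sum_of_ae_le hν _).1
    (integral_eq_sum_of_ae_le hν _).1 (integral_eq_sum_of_ae_le hν _).1]
  simp only [spaceMoment_eq_integral hν]
  ring

end Space

section Factorial

variable {ν : Measure ℕ} [IsProbabilityMeasure ν]

theorem lawCentral_two_eq_factMoment (h1 : Integrable (fun k : ℕ => (k.choose 1 : ℝ)) ν)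
    (h2 : Integrable (fun k : ℕ => (k.choose 2 : ℝ)) ν) :
    lawCentral ν 2 = 2 * factMoment (fun k => ν.real {k}) 2 + factMoment (fun k => ν.real {k}) 1 -
      factMoment (fun k => ν.real {k}) 1 ^ 2 := by
  rw [← integral_choose_eq_factMoment h1, ← integral_choose_eq_factMoment h2]
  exact integral_sub_integral_sq (f := fun k => k) h1 h2

theorem lawCentral_three_eq_factMoment (h1 : Integrable (fun k : ℕ => (k.choose 1 : ℝ)) ν)
    (h2 : Integrable (fun k : ℕ => (k.choose 2 : ℝ)) ν)
    (h3 : Integrable (fun k : ℕ => (k.choose 3 : ℝ)) ν) :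
    lawCentral ν 3 = 6 * factMoment (fun k => ν.real {k}) 3 +
      6 * factMoment (fun k => ν.real {k}) 2 + factMoment (fun k => ν.real {k}) 1 -
      3 * factMoment (fun k => ν.real {k}) 1 * (2 * factMoment (fun k => ν.real {k}) 2 +
        factMoment (fun k => ν.real {k}) 1) + 2 * factMoment (fun k => ν.real {k}) 1 ^ 3 := by
  rw [← integral_choose_eq_factMoment h1, ← integral_choose_eq_factMoment h2,
    ← integral_choose_eq_factMoment h3]
  exact integral_sub_integral_cube (f := fun k => k) h1 h2 h3

theorem variance_eq_lawCentral (ν : Measure ℕ) :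
    variance (fun k : ℕ => (k : ℝ)) ν = lawCentral ν 2 := by
  rw [variance_eq_integral (measurable_of_countable _).aemeasurable]
  rfl

end Factorial

theorem memLp_two_of_integrable_choose {ν : Measure ℕ}
    (h1 : Integrable (fun k : ℕ => (k.choose 1 : ℝ)) ν)
    (h2 : Integrable (fun k : ℕ => (k.choose 2 : ℝ)) ν) :
    MemLp (fun k : ℕ => (k : ℝ)) 2 ν := by
  rw [memLp_two_iff_integrable_sq (measurable_of_countable _).aestronglyMeasurable]
  refine ((h2.const_mul 2).add h1).congr (Eventually.of_forall fun k => ?_)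
  simp only [Pi.add_apply, Nat.cast_choose_two, Nat.choose_one_right]
  ring

/-! ### Second-order expansion at `1` -/

/-- Without arrivals the stationary queue is empty: `(Q - S)⁺` and `Q` have the same law and
`(Q - S)⁺ ≤ Q`, so they agree almost surely, while `S` is nonzero with positive probability and
independent of `Q`. -/
theorem lawPGF_eq_one_of_arrivals_eq_zero {C : ℕ} {νQ νS νY : Measure ℕ} [IsProbabilityMeasure νQ]
    [IsProbabilityMeasure νS] [IsProbabilityMeasure νY]
    (hstat : ((νQ.prod νS).prod νY).map lindleyMap = νQ) (hS : ∀ᵐ b ∂νS, b ≤ C)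
    (hmean : 0 < lawMean νS) (hy : ∀ k, k ≠ 0 → νY.real {k} = 0) (z : ℂ) : lawPGF νQ z = 1 := by
  have hY0 : ∀ᵐ c ∂νY, c = 0 := by
    rw [ae_iff_of_countable]
    intro c hc
    by_contra hne
    exact hc ((measureReal_eq_zero_iff).1 (hy c hne))
  obtain ⟨b, hb0, hb⟩ : ∃ b, b ≠ 0 ∧ νS.real {b} ≠ 0 := by
    by_contra hcon
    push Not at hcon
    rw [lawMean, (integral_eq_sum_of_ae_le hS _).2, Finset.sum_eq_zero] at hmean
    · exact lt_irrefl _ hmean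
    · intro b _
      by_cases hb0 : b = 0
      · simp [hb0]
      · simp [hcon b hb0]
  set π := (νQ.prod νS).prod νY with hπ
  have hint : ∀ f : (ℕ × ℕ) × ℕ → ℕ, Integrable (fun t => (1 / 2 : ℝ) ^ f t) π := fun f =>
    Integrable.of_bound (measurable_of_countable _).aestronglyMeasurable 1
      (Eventually.of_forall fun k => by
        rw [norm_pow]
        exact pow_le_one₀ (norm_nonneg _) (by norm_num))
  have hY0' : ∀ᵐ t ∂π, t.2 = 0 := Measure.quasiMeasurePreserving_snd.ae hY0
  -- Any bounded strictly monotone test function would do in place of `(1 / 2) ^ k`.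
  have h1 : ∫ t, ((1 / 2 : ℝ) ^ lindleyMap t - (1 / 2 : ℝ) ^ t.1.1) ∂π = 0 := by
    refine (integral_sub (hint lindleyMap) (hint fun t => t.1.1)).trans (sub_eq_zero.2 ?_)
    have h2 : ∫ k, (1 / 2 : ℝ) ^ k ∂νQ = ∫ t, (1 / 2 : ℝ) ^ lindleyMap t ∂π := by
      conv_lhs => rw [← hstat]
      exact integral_map (measurable_of_countable _).aemeasurable
        (measurable_of_countable _).aestronglyMeasurable
    have h3 : ∫ k, (1 / 2 : ℝ) ^ k ∂νQ = ∫ t, (1 / 2 : ℝ) ^ t.1.1 ∂π := by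
      rw [hπ, integral_fun_fst (fun u : ℕ × ℕ => (1 / 2 : ℝ) ^ u.1),
        integral_fun_fst (fun a : ℕ => (1 / 2 : ℝ) ^ a)]
      simp
    rw [← h2, h3]
  have hsub : Integrable (fun t => (1 / 2 : ℝ) ^ lindleyMap t - (1 / 2 : ℝ) ^ t.1.1) π :=
    (hint lindleyMap).sub (hint fun t => t.1.1)
  rw [integral_eq_zero_iff_of_nonneg_ae ?_ hsub] at h1
  swap
  · filter_upwards [hY0'] with t ht
    simp only [Pi.zero_apply, sub_nonneg, lindleyMap, ht, add_zero]
    exact pow_le_pow_of_le_one (by norm_num) (by norm_num) (Nat.sub_le _ _)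
  have h4 : ∀ᵐ t ∂π, t.1.1 = 0 ∨ t.1.2 = 0 := by
    filter_upwards [h1, hY0'] with t ht ht0
    simp only [Pi.zero_apply, sub_eq_zero, lindleyMap, ht0, add_zero] at ht
    have := pow_right_injective₀ (a := (1 / 2 : ℝ)) (by norm_num) (by norm_num) ht
    omega
  have hq : ∀ a, a ≠ 0 → νQ.real {a} = 0 := by
    intro a ha
    rw [ae_iff_of_countable] at h4
    have hy0 : νY.real {0} = 1 := by
      rw [← (hasSum_measureReal_singleton νY).tsum_eq, tsum_eq_single 0 hy]
    by_contra hne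
    have h5 : π {((a, b), 0)} ≠ 0 := by
      rw [hπ, ← Set.singleton_prod_singleton, ← Set.singleton_prod_singleton, Measure.prod_prod,
        Measure.prod_prod]
      refine mul_ne_zero (mul_ne_zero ?_ ?_) ?_ <;> intro h <;> simp_all [measureReal_def]
    have h6 := h4 ((a, b), 0) h5
    simp only at h6
    omega
  have hq0 : νQ.real {0} = 1 := by
    rw [← (hasSum_measureReal_singleton νQ).tsum_eq, tsum_eq_single 0 hq]
  rw [lawPGF, tsum_eq_single 0 (fun k hk => by simp [hq k hk]), hq0]
  simp

/-- Second-order expansion at `1` of a product of linear factors. -/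
theorem exists_prod_sub_eq {ι : Type*} (t : Finset ι) (w : ι → ℂ) (hw : ∀ i ∈ t, w i ≠ 1) :
    ∃ k : ℂ → ℂ, Continuous k ∧
      k 1 = ((∑ i ∈ t, 1 / (1 - w i)) ^ 2 - ∑ i ∈ t, 1 / (1 - w i) ^ 2) / 2 ∧
      ∀ z, ∏ i ∈ t, (z - w i) = (∏ i ∈ t, (1 - w i)) *
        (1 + (z - 1) * ((∑ i ∈ t, 1 / (1 - w i)) + (z - 1) * k z)) := by
  classical
  induction t using Finset.induction_on with
  | empty => exact ⟨fun _ => 0, continuous_const, by simp, by simp⟩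
  | insert a t ha ih =>
    obtain ⟨k, hk, hk1, hkz⟩ := ih fun i hi => hw i (Finset.mem_insert_of_mem hi)
    have ha1 : 1 - w a ≠ 0 := sub_ne_zero.2 (hw a (Finset.mem_insert_self a t)).symm
    refine ⟨fun z => k z + (∑ i ∈ t, 1 / (1 - w i)) * (1 / (1 - w a)) +
      (z - 1) * (1 / (1 - w a)) * k z, by fun_prop, ?_, fun z => ?_⟩
    · simp only [sub_self, zero_mul, add_zero]
      rw [Finset.sum_insert ha, Finset.sum_insert ha, hk1]
      field_simp
      ring
    · rw [Finset.prod_insert ha, Finset.prod_insert ha, Finset.sum_insert ha, hkz]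
      generalize ∑ i ∈ t, 1 / (1 - w i) = A
      field_simp
      ring

theorem iterGeom_one_eq (C : ℕ) (z : ℂ) : iterGeom 1 C z =
    C + (z - 1) * (C.choose 2 + (z - 1) * iterGeom 3 C z) := by
  rw [iterGeom_eq_choose_add 1, iterGeom_eq_choose_add 2, Nat.choose_one_right]

/-- The second-order remainder in the expansion of `reducedDen` at `1`, see `reducedDen_eq`. -/
noncomputable def reducedDenRem (C : ℕ) (s y : ℕ → ℝ) (z : ℂ) : ℂ :=
  iterGeom 3 C z - (tailPGF y 3 z * spaceTail C s 0 z + factMoment y 2 * spaceTail C s 1 z +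
    factMoment y 1 * spaceTail C s 2 z) - spaceTail C s 3 z

section Expansion

variable {C : ℕ} {s y q : ℕ → ℝ}

theorem reducedDen_eq (hs1 : ∑ u ∈ Finset.range (C + 1), s u = 1) (hy : ∀ k, 0 ≤ y k)
    (hy1 : Summable fun k => y k * k.choose 1) (hy2 : Summable fun k => y k * k.choose 2)
    (hy3 : Summable fun k => y k * k.choose 3) {z : ℂ} (hz : ‖z‖ ≤ 1) :
    reducedDen C s y z = (C - factMoment y 1 - spaceMoment C s 1 : ℝ) + (z - 1) *
      ((C.choose 2 - factMoment y 2 - factMoment y 1 * spaceMoment C s 1 - spaceMoment C s 2 : ℝ) +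
        (z - 1) * reducedDenRem C s y z) := by
  have h0 : spaceMoment C s 0 = 1 := by simpa [spaceMoment] using hs1
  have e1 := tailPGF_eq_factMoment_add hy hy1 hy2 hz
  have e2 := tailPGF_eq_factMoment_add hy hy2 hy3 hz
  have f0 := spaceTail_eq_spaceMoment_add (C := C) (s := s) (m := 0) z
  have f1 := spaceTail_eq_spaceMoment_add (C := C) (s := s) (m := 1) z
  have f2 := spaceTail_eq_spaceMoment_add (C := C) (s := s) (m := 2) z
  rw [h0, map_one] at f0
  simp only [Complex.coe_algebraMap] at f1 f2
  simp only [zero_add, Nat.reduceAdd] at *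
  rw [reducedDen, reducedDenRem, iterGeom_one_eq, e1, e2]
  push_cast
  rw [f0, f1, f2]
  ring

theorem continuousOn_reducedDenRem (hy : ∀ k, 0 ≤ y k)
    (hy3 : Summable fun k => y k * k.choose 3) :
    ContinuousOn (reducedDenRem C s y) (Metric.closedBall 0 1) := by
  have h := fun m => (differentiable_spaceTail (C := C) (s := s) (m := m)).continuous.continuousOn
    (s := Metric.closedBall 0 1)
  exact ((differentiable_iterGeom 3 C).continuous.continuousOn.sub
    ((((continuousOn_tailPGF hy hy3).mul (h 0)).add (continuousOn_const.mul (h 1))).add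
      (continuousOn_const.mul (h 2)))).sub (h 3)

theorem reducedDenRem_apply_one (hs1 : ∑ u ∈ Finset.range (C + 1), s u = 1) :
    reducedDenRem C s y 1 = ((C.choose 3 - factMoment y 3 - factMoment y 2 * spaceMoment C s 1 -
      factMoment y 1 * spaceMoment C s 2 - spaceMoment C s 3 : ℝ) : ℂ) := by
  have h0 : spaceMoment C s 0 = 1 := by simpa [spaceMoment] using hs1
  simp only [reducedDenRem, iterGeom_apply_one, tailPGF_apply_one, spaceTail_apply_one, h0]
  simp only [Complex.coe_algebraMap]
  push_cast
  ring

/-- The first two binomial moments of `q` from the equation `Q E = Y M` and the expansions of `E`,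
`Y` and `M` at `1`. The limits are taken along real `x → 1⁻`. -/
theorem factMoment_eq_of_mul_reducedDen_eq (hs1 : ∑ u ∈ Finset.range (C + 1), s u = 1)
    (hq : ∀ k, 0 ≤ q k) (hq0 : HasSum q 1)
    (hy : ∀ k, 0 ≤ y k) (hy0 : HasSum y 1)
    (hy1 : Summable fun k => y k * k.choose 1) (hy2 : Summable fun k => y k * k.choose 2)
    (hy3 : Summable fun k => y k * k.choose 3)
    (hpos : 0 < C - factMoment y 1 - spaceMoment C s 1) {M k : ℂ → ℂ} {A : ℂ}
    (hk : Continuous k)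
    (hM : ∀ z, M z = (C - factMoment y 1 - spaceMoment C s 1 : ℝ) *
      (1 + (z - 1) * (A + (z - 1) * k z)))
    (hfun : ∀ z : ℂ, ‖z‖ < 1 → tailPGF q 0 z * reducedDen C s y z = tailPGF y 0 z * M z) :
    (Summable fun k => q k * k.choose 1) ∧ (Summable fun k => q k * k.choose 2) ∧
    (factMoment q 1 : ℂ) * (C - factMoment y 1 - spaceMoment C s 1 : ℝ) =
      (factMoment y 1 + A) * (C - factMoment y 1 - spaceMoment C s 1 : ℝ) -
      (C.choose 2 - factMoment y 2 - factMoment y 1 * spaceMoment C s 1 - spaceMoment C s 2 : ℝ) ∧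
    (factMoment q 2 : ℂ) * (C - factMoment y 1 - spaceMoment C s 1 : ℝ) =
      (factMoment y 1 * A + factMoment y 2 + k 1) * (C - factMoment y 1 - spaceMoment C s 1 : ℝ) -
      (C.choose 3 - factMoment y 3 - factMoment y 2 * spaceMoment C s 1 -
        factMoment y 1 * spaceMoment C s 2 - spaceMoment C s 3 : ℝ) -
      factMoment q 1 * (C.choose 2 - factMoment y 2 - factMoment y 1 * spaceMoment C s 1 -
        spaceMoment C s 2 : ℝ) := by
  rw [← reducedDenRem_apply_one hs1]
  set μ : ℝ := C - factMoment y 1 - spaceMoment C s 1 with hμ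
  set e₁ : ℝ := C.choose 2 - factMoment y 2 - factMoment y 1 * spaceMoment C s 1 -
    spaceMoment C s 2 with he₁
  have hμ0 : (μ : ℂ) ≠ 0 := by exact_mod_cast hpos.ne'
  have hone : (1 : ℂ) ∈ Metric.closedBall (0 : ℂ) 1 := by simp
  have tendsto_of : ∀ {f : ℂ → ℂ}, ContinuousOn f (Metric.closedBall 0 1) →
      Tendsto (fun x : ℝ => f x) (𝓝[<] 1) (𝓝 (f 1)) := fun hf =>
    Tendsto.comp (hf 1 hone) tendsto_ofReal_nhdsLT_one
  have hEq : ∀ z : ℂ, ‖z‖ ≤ 1 → reducedDen C s y z =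
      μ + (z - 1) * (e₁ + (z - 1) * reducedDenRem C s y z) := fun z hz =>
    reducedDen_eq hs1 hy hy1 hy2 hy3 hz
  have hE1 : reducedDen C s y 1 = μ := reducedDen_apply_one hs1
  have hy1' : Summable fun k => y k * k := by simpa using hy1
  have hEt := tendsto_of (continuousOn_reducedDen (C := C) (s := s) hy hy1')
  have hRt := tendsto_of (continuousOn_reducedDenRem (C := C) (s := s) hy hy3)
  have hY1t := tendsto_of (continuousOn_tailPGF hy hy1)
  have hY2t := tendsto_of (continuousOn_tailPGF hy hy2)
  have hkt := tendsto_of hk.continuousOn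
  have hMc : Continuous M := by
    rw [funext hM]
    fun_prop
  have hMt := tendsto_of hMc.continuousOn
  have hxt := tendsto_of (f := fun z => z - 1) (by fun_prop)
  have hM1 : M 1 = μ := by simp [hM]
  rw [hE1] at hEt
  rw [tailPGF_apply_one] at hY1t hY2t
  rw [hM1] at hMt
  rw [sub_self] at hxt
  have hE0 : ∀ᶠ x : ℝ in 𝓝[<] 1, reducedDen C s y x ≠ 0 := hEt.eventually_ne hμ0
  have hIoo : ∀ᶠ x : ℝ in 𝓝[<] 1, ‖(x : ℂ)‖ < 1 ∧ (x : ℂ) - 1 ≠ 0 := by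
    filter_upwards [Ioo_mem_nhdsLT (show (0 : ℝ) < 1 by norm_num)] with x hx
    rw [Complex.norm_real, Real.norm_of_nonneg hx.1.le]
    exact ⟨hx.2, sub_ne_zero.2 (by exact_mod_cast hx.2.ne)⟩
  have hY0m : factMoment y 0 = 1 := by simpa [factMoment] using hy0.tsum_eq
  have hQ0m : factMoment q 0 = 1 := by simpa [factMoment] using hq0.tsum_eq
  have hq0s : Summable fun k => q k * k.choose 0 := by simpa using hq0.summable
  have hy0s : Summable fun k => y k * k.choose 0 := by simpa using hy0.summable
  -- `r` is `(Q - 1) / (z - 1)`, solved from `Q E = Y M`; the constant terms cancel since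
  -- `M 1 = E 1`.
  obtain ⟨hq1s, hq1⟩ := factMoment_succ_of_tendsto (m := 0) hq hq0s
    (r := fun z => (tailPGF y 1 z * M z + μ * A - e₁ +
      (z - 1) * (μ * k z - reducedDenRem C s y z)) / reducedDen C s y z)
    (l := (factMoment y 1 * μ + μ * A - e₁ +
      0 * (μ * k 1 - reducedDenRem C s y 1)) / μ) (by
      filter_upwards [hE0, hIoo] with x hx hx1
      have h1 := hfun x hx1.1
      have h2 := tailPGF_eq_factMoment_add hy hy0s hy1 hx1.1.le
      have h3 := hEq x hx1.1.le
      simp only [hY0m, Complex.ofReal_one, zero_add] at h2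
      apply mul_right_cancel₀ hx
      rw [h1, hQ0m, Complex.ofReal_one, add_mul, mul_assoc, div_mul_cancel₀ _ hx]
      linear_combination M x * h2 + hM x - h3)
    ((((hY1t.mul hMt).add_const _).sub_const _ |>.add
      (hxt.mul ((hkt.const_mul _).sub hRt))).div hEt hμ0)
  rw [zero_add] at hq1s hq1
  rw [eq_div_iff hμ0] at hq1
  -- The next quotient; here the constant terms cancel by the value of the first moment.
  obtain ⟨hq2s, hq2⟩ := factMoment_succ_of_tendsto (m := 1) hq hq1s
    (r := fun z => (factMoment y 1 * (μ * A + (z - 1) * (μ * k z)) + tailPGF y 2 z * M z +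
      μ * k z - reducedDenRem C s y z -
      factMoment q 1 * (e₁ + (z - 1) * reducedDenRem C s y z)) / reducedDen C s y z)
    (l := (factMoment y 1 * (μ * A + 0 * (μ * k 1)) + factMoment y 2 * μ +
      μ * k 1 - reducedDenRem C s y 1 -
      factMoment q 1 * (e₁ + 0 * reducedDenRem C s y 1)) / μ) (by
      filter_upwards [hE0, hIoo] with x hx hx1
      have h1 := hfun x hx1.1
      have h2 := tailPGF_eq_factMoment_add hy hy0s hy1 hx1.1.le
      have h3 := hEq x hx1.1.le
      have h4 := tailPGF_eq_factMoment_add hy hy1 hy2 hx1.1.le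
      have h5 := tailPGF_eq_factMoment_add hq hq0s hq1s hx1.1.le
      simp only [hY0m, hQ0m, Complex.ofReal_one, zero_add, Nat.reduceAdd] at h2 h4 h5
      apply mul_right_cancel₀ hx
      apply mul_left_cancel₀ hx1.2
      rw [add_mul, mul_assoc ((x : ℂ) - 1) (_ / _), div_mul_cancel₀ _ hx]
      linear_combination -reducedDen C s y x * h5 + h1 + M x * h2 + ((x : ℂ) - 1) * M x * h4 +
        (1 + ((x : ℂ) - 1) * factMoment y 1) * hM x -
        (1 + ((x : ℂ) - 1) * factMoment q 1) * h3 - ((x : ℂ) - 1) * hq1)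
    ((((((hxt.mul (hkt.const_mul _)).const_add _).const_mul _).add (hY2t.mul hMt)).add
      (hkt.const_mul _) |>.sub hRt |>.sub (((hxt.mul hRt).const_add _).const_mul _)).div hEt hμ0)
  rw [eq_div_iff hμ0] at hq2
  simp only [Nat.reduceAdd] at hq2s hq2
  refine ⟨hq1s, hq2s, ?_, ?_⟩
  · linear_combination hq1
  · linear_combination hq2

end Expansion

theorem reducedDen_apply_one_eq_eval {C : ℕ} {s y q : ℕ → ℝ}
    (hq : ∀ k, 0 ≤ q k) (hq0 : HasSum q 1) (hy : ∀ k, 0 ≤ y k) (hy0 : HasSum y 1)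
    (hy1 : Summable fun k => y k * k) {M : ℂ → ℂ} (hM : Continuous M)
    (hfun : ∀ z : ℂ, ‖z‖ < 1 → tailPGF q 0 z * reducedDen C s y z = tailPGF y 0 z * M z) :
    reducedDen C s y 1 = M 1 := by
  have tendsto_of : ∀ {f : ℂ → ℂ}, ContinuousOn f (Metric.closedBall 0 1) →
      Tendsto (fun x : ℝ => f x) (𝓝[<] 1) (𝓝 (f 1)) := fun hf =>
    Tendsto.comp (hf 1 (by simp)) tendsto_ofReal_nhdsLT_one
  have hY0m : tailPGF y 0 1 = 1 := by
    rw [tailPGF_apply_one]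
    simp [factMoment, hy0.tsum_eq]
  have hQ0m : tailPGF q 0 1 = 1 := by
    rw [tailPGF_apply_one]
    simp [factMoment, hq0.tsum_eq]
  have h1 := (tendsto_of (continuousOn_tailPGF (m := 0) hq (by simpa using hq0.summable))).mul
    (tendsto_of (continuousOn_reducedDen (C := C) (s := s) hy hy1))
  have h2 := (tendsto_of (continuousOn_tailPGF (m := 0) hy (by simpa using hy0.summable))).mul
    (tendsto_of hM.continuousOn)
  rw [hQ0m, one_mul] at h1
  rw [hY0m, one_mul] at h2
  refine tendsto_nhds_unique (h1.congr' ?_) h2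
  filter_upwards [Ioo_mem_nhdsLT (show (0 : ℝ) < 1 by norm_num)] with x hx
  refine hfun x ?_
  rw [Complex.norm_real, Real.norm_of_nonneg hx.1.le]
  exact hx.2

/-! ### Mean and variance of the queue length -/

/-- The algebra that turns binomial moments into the stated formulas: `q1, q2` belong to the
queue, `y1, y2, y3` to the arrivals and `v1, v2, v3` to the occupied space; `A` and `B` stand for
`∑ 1 / (1 - z i)` and `∑ 1 / (1 - z i) ^ 2`. -/
theorem mean_and_variance_of_factMoment {C y1 y2 y3 v1 v2 v3 q1 q2 : ℝ} {A B : ℂ}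
    (hpos : 0 < C - y1 - v1)
    (e1 : (q1 : ℂ) * (C - y1 - v1 : ℝ) = (y1 + A) * (C - y1 - v1 : ℝ) -
      (C * (C - 1) / 2 - y2 - y1 * v1 - v2 : ℝ))
    (e2 : (q2 : ℂ) * (C - y1 - v1 : ℝ) =
      (y1 * A + y2 + (A ^ 2 - B) / 2) * (C - y1 - v1 : ℝ) -
        (C * (C - 1) * (C - 2) / 6 - y3 - y2 * v1 - y1 * v2 - v3 : ℝ) -
        q1 * (C * (C - 1) / 2 - y2 - y1 * v1 - v2 : ℝ)) :
    (q1 : ℂ) = ((((2 * v2 + v1 - v1 ^ 2) + (2 * y2 + y1 - y1 ^ 2) +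
        (C - v1 - y1) * (1 + 2 * (C - v1 - C)) - (C - v1 - y1) ^ 2) /
        (2 * (C - v1 - y1)) : ℝ) : ℂ) + A ∧
    ((2 * q2 + q1 - q1 ^ 2 : ℝ) : ℂ) = ((1 / (12 * (C - v1 - y1) ^ 2) *
      (-4 * (-(6 * v3 + 6 * v2 + v1 - 3 * v1 * (2 * v2 + v1) + 2 * v1 ^ 3) -
          (6 * y3 + 6 * y2 + y1 - 3 * y1 * (2 * y2 + y1) + 2 * y1 ^ 3)) * (C - v1 - y1) +
        3 * ((2 * v2 + v1 - v1 ^ 2) + (2 * y2 + y1 - y1 ^ 2)) ^ 2 -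
        (6 * ((2 * v2 + v1 - v1 ^ 2) - (2 * y2 + y1 - y1 ^ 2)) - 1) * (C - v1 - y1) ^ 2 -
        (C - v1 - y1) ^ 4) : ℝ) : ℂ) - (B - A) := by
  obtain ⟨μ, hμ⟩ : ∃ μ : ℝ, μ = C - y1 - v1 := ⟨_, rfl⟩
  have hv : v1 = C - y1 - μ := by rw [hμ]; ring
  rw [← hμ] at hpos
  have hμ0 : (μ : ℂ) ≠ 0 := by exact_mod_cast hpos.ne'
  subst hv
  have hd1 : C - (C - y1 - μ) - y1 = μ := by ring
  rw [← hμ] at e1 e2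
  rw [hd1]
  push_cast at e1 e2 ⊢
  constructor
  · have h2 : (2 * μ : ℂ) ≠ 0 := mul_ne_zero two_ne_zero hμ0
    rw [← sub_eq_iff_eq_add, eq_div_iff h2]
    linear_combination 2 * e1
  · have h12 : (12 * μ ^ 2 : ℂ) ≠ 0 := mul_ne_zero (by norm_num) (pow_ne_zero _ hμ0)
    rw [eq_sub_iff_add_eq, one_div, inv_mul_eq_div, eq_div_iff h12]
    linear_combination 24 * μ * e2 + (12 * μ - 12 * (q1 * μ + ((y1 + A) * μ -
      (C * (C - 1) / 2 - y2 - y1 * (C - y1 - μ) - v2))) -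
      24 * (C * (C - 1) / 2 - y2 - y1 * (C - y1 - μ) - v2)) * e1

theorem proposition5 {Ω : Type*} [MeasurableSpace Ω] (P : Measure Ω) [IsProbabilityMeasure P]
    (C : ℕ) (lam : ℝ) (H : ℕ → Ω → ℝ) (Q S Y : ℕ → Ω → ℕ)
    (hqueue : IsBulkServiceQueue P C lam H Q S Y)
    -- the steady-state laws of the queue length, the available space and the arrivals
    (νQ νS νY : Measure ℕ) [IsProbabilityMeasure νQ] [IsProbabilityMeasure νS]
    [IsProbabilityMeasure νY]
    (hQ : IsSteadyState P Q νQ) (hS : IsSteadyState P S νS) (hY : IsSteadyState P Y νY)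
    -- the third moment of the arrivals is finite
    (hY3 : Integrable (fun k : ℕ => (k : ℝ) ^ 3) νY)
    -- stability (it forces `1 ≤ C`)
    (hstable : lawMean νY < lawMean νS) :
    -- the queue length has a finite second moment
    MemLp (fun k : ℕ => (k : ℝ)) 2 νQ ∧
    -- the denominator has exactly `C - 1` roots other than `1` in the closed unit disk
    (∃ z : Fin (C - 1) → ℂ, IsNonunitRootList (queueDen C νS νY) z) ∧
    ∀ z : Fin (C - 1) → ℂ, IsNonunitRootList (queueDen C νS νY) z →
      ((lawMean νQ : ℝ) : ℂ) =
        (((lawCentral νS 2 + lawCentral νY 2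
            + (lawMean νS - lawMean νY) * (1 + 2 * (lawMean νS - C))
            - (lawMean νS - lawMean νY) ^ 2)
          / (2 * (lawMean νS - lawMean νY)) : ℝ) : ℂ)
        + ∑ i, 1 / (1 - z i) ∧
      ((variance (fun k : ℕ => (k : ℝ)) νQ : ℝ) : ℂ) =
        ((1 / (12 * (lawMean νS - lawMean νY) ^ 2) *
          (-4 * (lawCentral νS 3 - lawCentral νY 3) * (lawMean νS - lawMean νY)
            + 3 * (lawCentral νS 2 + lawCentral νY 2) ^ 2
            - (6 * (lawCentral νS 2 - lawCentral νY 2) - 1) * (lawMean νS - lawMean νY) ^ 2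
            - (lawMean νS - lawMean νY) ^ 4) : ℝ) : ℂ)
        - ∑ i, z i / (1 - z i) ^ 2 := by
  have hstat := hqueue.map_lindleyMap hQ hS hY
  have hSC := hqueue.space_steadyState_le hS
  obtain ⟨h0, h01⟩ := hqueue.arrivals_pos hY
  have hi1 := integrable_choose hY3 (m := 1) (by norm_num) (by norm_num)
  have hi2 := integrable_choose hY3 (m := 2) (by norm_num) (by norm_num)
  have hi3 := integrable_choose hY3 (m := 3) (by norm_num) (by norm_num)
  have hnn : ∀ m k : ℕ, (0 : ℝ) ≤ (k.choose m : ℝ) := fun m k => Nat.cast_nonneg _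
  have hy1 := (integrable_nat_iff_summable (hnn 1)).1 hi1
  have hy2 := (integrable_nat_iff_summable (hnn 2)).1 hi2
  have hy3 := (integrable_nat_iff_summable (hnn 3)).1 hi3
  have hy1' : Summable fun k => νY.real {k} * k := by simpa using hy1
  have hmY := lawMean_eq_factMoment hi1
  have hmS := lawMean_eq_sub_spaceMoment hSC
  have hs1 := sum_measureReal_singleton_eq_one hSC
  have hqsum := hasSum_measureReal_singleton νQ
  have hysum := hasSum_measureReal_singleton νY
  have hqn : ∀ k, 0 ≤ νQ.real {k} := fun _ => measureReal_nonneg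
  have hyn : ∀ k, 0 ≤ νY.real {k} := fun _ => measureReal_nonneg
  have hpos : 0 < C - factMoment (fun k => νY.real {k}) 1 -
      spaceMoment C (fun u => νS.real {u}) 1 := by
    rw [hmY, hmS] at hstable
    linarith
  have hmean : 0 < lawMean νS :=
    lt_of_le_of_lt (integral_nonneg fun k => Nat.cast_nonneg k) hstable
  have hfun : ∀ z : ℂ, ‖z‖ < 1 → lawPGF νQ z *
      reducedDen C (fun u => νS.real {u}) (fun k => νY.real {k}) z =
        lawPGF νY z * (boundaryPoly C νQ νS).eval z := by
    intro z hz
    have h1 := lawPGF_mul_eq hstat hSC hz.le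
    have h2 := sub_one_mul_reducedDen (C := C) (s := fun u => νS.real {u})
      (y := fun k => νY.real {k}) hs1 hyn hysum hy1' hz.le
    have h3 : z - 1 ≠ 0 := fun h => by
      rw [sub_eq_zero.1 h] at hz
      simp at hz
    apply mul_left_cancel₀ h3
    have h4 : spaceTail C (fun u => νS.real {u}) 0 z =
      ∑ u ∈ Finset.range (C + 1), (νS.real {u} : ℂ) * z ^ (C - u) := rfl
    rw [← h4] at h1
    rw [← lawPGF_eq_tailPGF] at h2
    linear_combination h1 + lawPGF νQ z * h2
  have hM1 := reducedDen_apply_one_eq_eval hqn hqsum hyn hysum hy1'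
    (boundaryPoly C νQ νS).continuous hfun
  rw [reducedDen_apply_one hs1] at hM1
  have hM0 : boundaryPoly C νQ νS ≠ 0 := fun h => by
    rw [h, Polynomial.eval_zero] at hM1
    exact hpos.ne' (by exact_mod_cast hM1)
  obtain ⟨w, c, hw, hMw⟩ : ∃ (w : Fin (C - 1) → ℂ) (c : ℂ),
      IsNonunitRootList (queueDen C νS νY) w ∧ boundaryPoly C νQ νS =
        Polynomial.C c * ∏ i, (Polynomial.X - Polynomial.C (w i)) := by
    rcases h01 with h1 | h1
    · exact exists_rootList_of_pos hSC hy1' h0 h1 hpos (natDegree_boundaryPoly_le C νQ νS) hM0 hfun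
    · refine exists_rootList_of_eq_zero hSC h1 hpos (natDegree_boundaryPoly_le C νQ νS) hM0
        fun z hz => ?_
      have hY1 : lawPGF νY z = 1 := by
        have hy0 : νY.real {0} = 1 := by rw [← hysum.tsum_eq, tsum_eq_single 0 h1]
        rw [lawPGF, tsum_eq_single 0 (fun k hk => by simp [h1 k hk]), hy0]
        simp
      have h2 := hfun z hz
      rwa [lawPGF_eq_one_of_arrivals_eq_zero hstat hSC hmean h1, hY1, one_mul, one_mul] at h2
  have hfac : ∀ z : Fin (C - 1) → ℂ, IsNonunitRootList (queueDen C νS νY) z →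
      ∃ k : ℂ → ℂ, Continuous k ∧
        k 1 = ((∑ i, 1 / (1 - z i)) ^ 2 - ∑ i, 1 / (1 - z i) ^ 2) / 2 ∧
        ∀ x, (boundaryPoly C νQ νS).eval x = (C - factMoment (fun k => νY.real {k}) 1 -
          spaceMoment C (fun u => νS.real {u}) 1 : ℝ) *
            (1 + (x - 1) * ((∑ i, 1 / (1 - z i)) + (x - 1) * k x)) := by
    intro z hz
    obtain ⟨k, hk, hk1, hkz⟩ := exists_prod_sub_eq Finset.univ z fun i _ => (hz.1 i).2
    have hMz : ∀ x, (boundaryPoly C νQ νS).eval x = c * ∏ i, (x - z i) := fun x => by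
      rw [hMw, prod_X_sub_C_eq_of_map_eq (hw.map_eq hz), ← prod_X_sub_C_eq_of_map_eq (w := z) rfl,
        Polynomial.eval_mul, Polynomial.eval_C, Polynomial.eval_prod]
      simp
    refine ⟨k, hk, hk1, fun x => ?_⟩
    rw [hM1, hMz 1, hMz x, hkz x]
    ring
  have hmoments := fun {k : ℂ → ℂ} {A : ℂ} (hk : Continuous k) hkM =>
    factMoment_eq_of_mul_reducedDen_eq (C := C) (s := fun u => νS.real {u}) hs1 hqn
      hqsum hyn hysum hy1 hy2 hy3 hpos (A := A) hk hkM hfun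
  obtain ⟨k₀, hk₀, -, hkM₀⟩ := hfac w hw
  obtain ⟨hq1s, hq2s, -, -⟩ := hmoments hk₀ hkM₀
  have hqi1 := (integrable_nat_iff_summable (hnn 1)).2 hq1s
  have hqi2 := (integrable_nat_iff_summable (hnn 2)).2 hq2s
  refine ⟨memLp_two_of_integrable_choose hqi1 hqi2, ⟨w, hw⟩, fun z hz => ?_⟩
  obtain ⟨k, hk, hk1, hkM⟩ := hfac z hz
  obtain ⟨-, -, e1, e2⟩ := hmoments hk hkM
  rw [hk1] at e2
  have hsum : ∑ i, z i / (1 - z i) ^ 2 = ∑ i, 1 / (1 - z i) ^ 2 - ∑ i, 1 / (1 - z i) := by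
    rw [← Finset.sum_sub_distrib]
    refine Finset.sum_congr rfl fun i _ => ?_
    have : 1 - z i ≠ 0 := sub_ne_zero.2 (hz.1 i).2.symm
    field_simp
    ring
  rw [variance_eq_lawCentral, lawCentral_two_eq_factMoment hqi1 hqi2,
    lawCentral_two_eq_factMoment hi1 hi2, lawCentral_three_eq_factMoment hi1 hi2 hi3,
    lawCentral_two_eq_spaceMoment hSC, lawCentral_three_eq_spaceMoment hSC,
    lawMean_eq_factMoment hqi1, hmY, hmS, hsum]
  rw [Nat.cast_choose_two] at e1 e2
  rw [cast_choose_three] at e2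
  exact mean_and_variance_of_factMoment hpos e1 e2
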